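/- A simplicial complex $\Gamma$ on a finite vertex set $V$ is a collection of subsets of $V$ (faces), containing $\emptyset$ and closed under taking subsets. Its dimension is one less than the maximum cardinality of a face, and $f_j(\Gamma)$ is the number of faces with $j+1$ vertices. $\Gamma$ is flag if a set $F\subseteq V$ is a face whenever all two-element subsets of $F$ are faces. For a face $F$, the link $\mathrm{lk}_\Gamma(F)$ is the complex on $V\setminus F$ with faces $\{G\setminus F : F\subseteq G\in\Gamma\}$, and for a complex $\Delta$ and a set $W$ of its vertices, $\Delta[W]$ is the complex of the faces of $\Delta$ contained in $W$. Fix a field $\mathbf k$. The $q$-girth of $\Gamma$ is $$\mathrm{gr}_q(\Gamma)=\min\{|W| : \tilde H_q(\mathrm{lk}_\Gamma(F)[W];\mathbf k)\neq 0 \text{ for some face } F\in\Gamma \text{ (possibly empty) and some } W\subseteq V\setminus F\},$$ with $\mathrm{gr}_q(\Gamma)=\infty$ if no such $W$ exists; here $\tilde H_q$ is reduced simplicial homology. For integers $p,r\ge 2$ and $i\ge p-1$ define $a_{p,r,i}$ recursively by $$a_{2,r,i}=1+\tfrac1r+\cdots+\tfrac1{r^{i-1}}\ (i\ge 1),\qquad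 a_{p,r,p-1}=p-1,\qquad a_{p,r,i}=\tfrac12a_{p-1,r,i-1}+\tfrac12a_{p,r,i-1}+1\quad(p\ge 3,\ i\ge p).$$ Theorem. For all integers $p,r\ge 2$ and $i\ge p-1$ there is a constant $C_{p,r,i}$, depending only on $p,r,i$, such that for every field $\mathbf k$ and every flag $(d-1)$-dimensional simplicial complex $\Gamma$ with $n$ vertices satisfying $\mathrm{gr}_{p-1}(\Gamma)>2p+2r-4$, $$f_{i-1}(\Gamma)\le C_{p,r,i}\,d^{\,i-a_{p,r,i}}\,n^{a_{p,r,i}}.$$ -/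

import Mathlib

/-! Simplicial complexes on a finite vertex set `V` are `PreAbstractSimplicialComplex V`. That
structure records only the nonempty faces; the empty set is regarded as a face of every complex,
as is usual for reduced homology and for `lk(∅) = K`. -/

namespace GirthComplex

noncomputable section

variable {V : Type*}

/-- `F` is a face of `K`, the empty face included. -/
def IsFace (K : PreAbstractSimplicialComplex V) (F : Finset V) : Prop :=
  F = ∅ ∨ F ∈ K

/-- The induced subcomplex `K[W]`: the faces of `K` contained in `W`. -/
def induced (K : PreAbstractSimplicialComplex V) (W : Finset V) :
    PreAbstractSimplicialComplex V where
  faces := {G | G ∈ K ∧ G ⊆ W}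
  isRelLowerSet_faces := fun _ hG =>
    ⟨(K.isRelLowerSet_faces hG.1).1, fun _ hT hne =>
      ⟨(K.isRelLowerSet_faces hG.1).2 hT hne, hT.trans hG.2⟩⟩

/-- The link of `F` in `K`: the sets `G` disjoint from `F` such that `F ∪ G` is a face of `K`. -/
def link [DecidableEq V] (K : PreAbstractSimplicialComplex V) (F : Finset V) :
    PreAbstractSimplicialComplex V where
  faces := {G | G.Nonempty ∧ Disjoint F G ∧ F ∪ G ∈ K}
  isRelLowerSet_faces := fun _ hG =>
    ⟨hG.1, fun _ hT hne => ⟨hne, hG.2.1.mono_right hT,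
      (K.isRelLowerSet_faces hG.2.2).2 (Finset.union_subset_union_right hT)
        (hne.mono Finset.subset_union_right)⟩⟩

/-- The dimension: one less than the maximum cardinality of a face (for finite `V`). -/
def dim (K : PreAbstractSimplicialComplex V) : ℤ :=
  (sSup (Finset.card '' K.faces) : ℕ) - 1

/-- The face number `f_j`: the number of faces with `j + 1` vertices. -/
def faceNumber (K : PreAbstractSimplicialComplex V) (j : ℕ) : ℕ :=
  {F : Finset V | F ∈ K ∧ F.card = j + 1}.ncard

/-- `K` is flag: a set is a face as soon as all its two-element subsets are faces. (In particular
every vertex is a face.) -/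
def IsFlag (K : PreAbstractSimplicialComplex V) : Prop :=
  ∀ F : Finset V, (∀ T ⊆ F, T.card = 2 → IsFace K T) → IsFace K F

section Homology

variable (k : Type*) [Field k] [Fintype V] [LinearOrder V]

/-- The augmented simplicial boundary map on formal `k`-linear combinations `c` of finite subsets
of the ordered set `V`, where `c F` is the coefficient of `F`. It is the linear map with
`∂ F = ∑_{v ∈ F} (-1)^{#{u ∈ F | u < v}} (F \ {v})` (see `boundary_single`), so a vertex is sent
to the empty face and the empty face to `0`; below it is written coefficient by coefficient. -/
def boundary : (Finset V → k) →ₗ[k] (Finset V → k) where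
  toFun c G := ∑ v ∈ Gᶜ, (-1) ^ (G.filter (· < v)).card * c (insert v G)
  map_add' c c' := by
    ext G
    simp [mul_add, Finset.sum_add_distrib]
  map_smul' a c := by
    ext G
    simp [Finset.mul_sum, mul_left_comm]

/-- The chains of `K` spanned by the faces with exactly `m` vertices, i.e. the simplicial chains
of degree `m - 1`, where `m = 0` gives the augmentation term spanned by the empty face. -/
def chains (K : PreAbstractSimplicialComplex V) (m : ℕ) : Submodule k (Finset V → k) where
  carrier := {c | ∀ F, c F ≠ 0 → IsFace K F ∧ F.card = m}
  zero_mem' := fun F h => absurd rfl h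
  add_mem' := fun {c c'} hc hc' F h => by
    by_cases h0 : c F = 0
    · exact hc' F (by simpa [h0] using h)
    · exact hc F h0
  smul_mem' := fun a c hc F h => hc F (right_ne_zero_of_mul (by simpa using h))

/-- The reduced `q`-cycles of `K`, `q ≥ 0`. -/
def cycles (K : PreAbstractSimplicialComplex V) (q : ℕ) : Submodule k (Finset V → k) :=
  chains k K (q + 1) ⊓ LinearMap.ker (boundary k)

/-- The `q`-boundaries of `K`. -/
def boundaries (K : PreAbstractSimplicialComplex V) (q : ℕ) : Submodule k (Finset V → k) :=
  (chains k K (q + 2)).map (boundary k)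

theorem boundary_single (F : Finset V) :
    boundary k (Pi.single F 1) =
      ∑ v ∈ F, (-1 : k) ^ (F.filter (· < v)).card • Pi.single (F.erase v) (1 : k) := by
  ext G
  simp only [boundary, LinearMap.coe_mk, AddHom.coe_mk, Finset.sum_apply, Pi.smul_apply,
    smul_eq_mul, Pi.single_apply, mul_ite, mul_one, mul_zero]
  rw [← Finset.sum_filter, ← Finset.sum_filter]
  have hset : Gᶜ.filter (fun v => insert v G = F) = F.filter (fun v => G = F.erase v) := by
    ext v
    simp only [Finset.mem_filter, Finset.mem_compl]
    constructor
    · rintro ⟨hv, rfl⟩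
      exact ⟨Finset.mem_insert_self _ _, (Finset.erase_insert hv).symm⟩
    · rintro ⟨hv, rfl⟩
      exact ⟨Finset.notMem_erase _ _, Finset.insert_erase hv⟩
  rw [hset]
  refine Finset.sum_congr rfl fun v hv => ?_
  rw [(Finset.mem_filter.1 hv).2, Finset.filter_erase, Finset.erase_eq_of_notMem (by simp)]

/-- The boundary map squares to zero. -/
theorem boundary_boundary (c : Finset V → k) : boundary k (boundary k c) = 0 := by
  ext G
  simp only [boundary, LinearMap.coe_mk, AddHom.coe_mk, Pi.zero_apply, Finset.mul_sum]
  rw [Finset.sum_sigma']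
  refine Finset.sum_involution (fun x _ => ⟨x.2, x.1⟩) ?_ ?_ ?_ ?_
  · rintro ⟨v, w⟩ h
    simp only [Finset.mem_sigma, Finset.mem_compl, Finset.mem_insert, not_or] at h
    obtain ⟨hv, hwv, hw⟩ := h
    have key : ∀ a b : V, a ∉ G → a < b →
        ((insert a G).filter (· < b)).card = (G.filter (· < b)).card + 1 ∧
        ((insert b G).filter (· < a)).card = (G.filter (· < a)).card := by
      intro a b ha hab
      constructor
      · rw [Finset.filter_insert, if_pos hab, Finset.card_insert_of_notMem (by simp [ha])]
      · rw [Finset.filter_insert, if_neg hab.not_gt]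
    dsimp only
    rw [Finset.insert_comm w v G]
    rcases lt_or_gt_of_ne hwv with h | h
    · obtain ⟨h1, h2⟩ := key w v hw h
      rw [h1, h2, pow_succ]
      ring
    · obtain ⟨h1, h2⟩ := key v w hv h
      rw [h1, h2, pow_succ]
      ring
  · rintro ⟨v, w⟩ h _ he
    simp only [Finset.mem_sigma, Finset.mem_compl, Finset.mem_insert, not_or] at h
    simp only [Sigma.mk.injEq] at he
    exact h.2.1 he.1
  · rintro ⟨v, w⟩ h
    simp only [Finset.mem_sigma, Finset.mem_compl, Finset.mem_insert, not_or] at h ⊢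
    exact ⟨h.2.2, fun e => h.2.1 e.symm, h.1⟩
  · rintro ⟨v, w⟩ _
    rfl

theorem boundaries_le_cycles (K : PreAbstractSimplicialComplex V) (q : ℕ) :
    boundaries k K q ≤ cycles k K q := by
  rintro _ ⟨c, hc, rfl⟩
  refine ⟨fun G hG => ?_, boundary_boundary k c⟩
  obtain ⟨v, hv, hne⟩ := Finset.exists_ne_zero_of_sum_ne_zero hG
  obtain ⟨hf, hcard⟩ := hc _ (right_ne_zero_of_mul hne)
  rw [Finset.card_insert_of_notMem (Finset.mem_compl.1 hv)] at hcard
  have hG1 : G.card = q + 1 := by omega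
  have hGne : G.Nonempty := Finset.card_pos.1 (by omega)
  refine ⟨Or.inr ?_, hG1⟩
  rcases hf with hf | hf
  · exact absurd hf (Finset.insert_ne_empty _ _)
  · exact (K.isRelLowerSet_faces hf).2 (Finset.subset_insert _ _) hGne

/-- The reduced simplicial homology `H̃_q(K; k)`, `q ≥ 0`: cycles modulo boundaries. -/
abbrev ReducedHomology (K : PreAbstractSimplicialComplex V) (q : ℕ) :=
  cycles k K q ⧸ (boundaries k K q).submoduleOf (cycles k K q)

/-- The `q`-girth `gr_q(K)` over `k`: the least `|W|` such that `H̃_q(lk_K(F)[W]; k) ≠ 0` for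
some face `F` (possibly empty) and some set `W` of vertices outside `F`; it is `⊤` if there is no
such `W`. -/
def girth (K : PreAbstractSimplicialComplex V) (q : ℕ) : ℕ∞ :=
  sInf {m : ℕ∞ | ∃ F W : Finset V, IsFace K F ∧ Disjoint F W ∧
    Nontrivial (ReducedHomology k (induced (link K F) W) q) ∧ m = (W.card : ℕ∞)}

end Homology

/-- The exponents `a_{p,r,i}`: `a_{2,r,i} = 1 + 1/r + ⋯ + 1/r^(i-1)`, `a_{p,r,p-1} = p - 1`, and
`a_{p,r,i} = (a_{p-1,r,i-1} + a_{p,r,i-1}) / 2 + 1` for `p ≥ 3`, `i ≥ p`. They are meant for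
`p ≥ 2` and `i ≥ p - 1`; other values are irrelevant. -/
def exponent : ℕ → ℕ → ℕ → ℝ
  | 0, _, _ => 0
  | 1, _, _ => 0
  | 2, r, i => ∑ j ∈ Finset.range i, (1 / (r : ℝ)) ^ j
  | p + 3, _, 0 => (p : ℝ) + 2
  | p + 3, r, i + 1 =>
      if i + 1 < p + 3 then (p : ℝ) + 2
      else 1 / 2 * exponent (p + 2) r i + 1 / 2 * exponent (p + 3) r i + 1

theorem exponent_two (r i : ℕ) (hr : 2 ≤ r) (hi : 1 ≤ i) :
    exponent 2 r i = ((r : ℝ) ^ i - 1) / ((r : ℝ) ^ i - (r : ℝ) ^ (i - 1)) := by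
  obtain ⟨j, rfl⟩ := Nat.exists_eq_add_of_le' hi
  have h2 : (2 : ℝ) ≤ r := by exact_mod_cast hr
  have h0 : (r : ℝ) ≠ 0 := by linarith
  have h1 : (r : ℝ) - 1 ≠ 0 := by linarith
  have h1' : 1 - (r : ℝ) ≠ 0 := by linarith
  have hne : 1 / (r : ℝ) ≠ 1 := by
    intro h
    rw [div_eq_one_iff_eq h0] at h
    linarith
  have hd : (r : ℝ) ^ (j + 1) - (r : ℝ) ^ j ≠ 0 := by
    rw [pow_succ, ← mul_sub_one]
    exact mul_ne_zero (pow_ne_zero _ h0) h1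
  rw [exponent, geom_sum_eq hne, Nat.add_sub_cancel, one_div, inv_pow]
  have hd' : (r : ℝ)⁻¹ - 1 ≠ 0 := by
    rw [← one_div]
    exact sub_ne_zero.2 hne
  rw [div_eq_div_iff hd' hd]
  field_simp
  ring

theorem exponent_base (p r : ℕ) (hp : 2 ≤ p) : exponent p r (p - 1) = (p : ℝ) - 1 := by
  obtain ⟨q, rfl⟩ := Nat.exists_eq_add_of_le' hp
  rcases q with _ | q
  · simp [exponent]
    norm_num
  · rw [show q + 1 + 2 - 1 = q + 1 + 1 by omega, show q + 1 + 2 = q + 3 by omega, exponent,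
      if_pos (by omega)]
    push_cast
    ring

theorem exponent_rec (p r i : ℕ) (hp : 3 ≤ p) (hi : p ≤ i) :
    exponent p r i =
      1 / 2 * exponent (p - 1) r (i - 1) + 1 / 2 * exponent p r (i - 1) + 1 := by
  obtain ⟨q, rfl⟩ := Nat.exists_eq_add_of_le' hp
  obtain ⟨j, rfl⟩ := Nat.exists_eq_add_of_le' (show 1 ≤ i by omega)
  rw [exponent, if_neg (by omega)]
  simp

end

end GirthComplex

/-! Write p = q + 2. The girth hypothesis forbids, in the graph of Γ, the q-fold suspension of an
induced cycle of length between 4 and 2r: iterated differences of cones over the cycle give a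
nonzero (q+1)-cycle on at most 2q + 2r vertices, which cannot bound because these vertices span no
clique of size q + 3 (`girth_le_of_hasSuspendedCycle`). Only the empty face is needed in the girth.
By flagness, it remains to count cliques in a graph with clique number at most d
(`hasCliqueCountBound`).

Case q = 0. Without induced four-cycles, the common neighbours of a nonadjacent pair form a clique,
so there are at most d of them. Hence large neighbourhoods are sparse, and a random walk seldom
creates a chord of length two. Conversely, at most d^(r-1) such chordless walks with r edges join
two given vertices: two walks leaving x through nonadjacent neighbours would close up to a short
induced cycle. Comparing the counts gives a vertex whose degree to the power r is O(d^(r-1) |X|)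
(`exists_nbrs_pow_le`); deleting such vertices one by one turns the exponent a into 1 + a/r.

From q to q + 1. Count (j+1)-cliques as extensions of j-cliques σ and apply Cauchy–Schwarz. If σ has
more than 2d extensions, a positive proportion of the pairs v, w of extensions are nonadjacent, and
σ lies in the common neighbourhood of v and w, which has no q-fold suspended cycle. So the square of
the (j+1)-clique count is governed by |X|² times the product of the j-clique bounds at levels q + 1
and q, which averages the exponents (`HasCliqueCountBound.succ`). -/

namespace CliqueCount

noncomputable section

open scoped Classical

variable {V : Type*}

/-! ### Graph vocabulary and suspended induced cycles -/

/-- The neighbours of `v` in `X`. -/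
def nbrs (G : SimpleGraph V) (X : Finset V) (v : V) : Finset V :=
  X.filter (G.Adj v)

/-- The common neighbours of `u` and `v` in `X`. -/
def commonNbrs (G : SimpleGraph V) (X : Finset V) (u v : V) : Finset V :=
  X.filter fun w => G.Adj u w ∧ G.Adj v w

/-- The cliques with `i` vertices in `X`. -/
def cliques (G : SimpleGraph V) (i : ℕ) (X : Finset V) : Finset (Finset V) :=
  (X.powersetCard i).filter fun S => G.IsClique (S : Set V)

/-- All cliques in `X` have at most `d` vertices. -/
def CliqueBound (G : SimpleGraph V) (X : Finset V) (d : ℕ) : Prop :=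
  ∀ S ⊆ X, G.IsClique (S : Set V) → S.card ≤ d

/-- `X` contains an induced cycle with at least `4` and at most `2 * r` vertices, given as an
induced path `v 0, …, v ℓ` and a further vertex adjacent exactly to its two ends. -/
def HasInducedCycle (G : SimpleGraph V) (r : ℕ) (X : Finset V) : Prop :=
  ∃ x ∈ X, ∃ (ℓ : ℕ) (v : ℕ → V), 2 ≤ ℓ ∧ ℓ + 2 ≤ 2 * r ∧
    (∀ i ≤ ℓ, v i ∈ X ∧ v i ≠ x ∧ (G.Adj x (v i) ↔ i = 0 ∨ i = ℓ)) ∧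
    ∀ i j, i < j → j ≤ ℓ → v i ≠ v j ∧ (G.Adj (v i) (v j) ↔ j = i + 1)

/-- `X` contains the induced `q`-fold suspension of an induced cycle with between `4` and `2 * r`
vertices. -/
def HasSuspendedCycle (G : SimpleGraph V) (r : ℕ) : ℕ → Finset V → Prop
  | 0, X => HasInducedCycle G r X
  | q + 1, X => ∃ u ∈ X, ∃ v ∈ X, u ≠ v ∧ ¬ G.Adj u v ∧
      HasSuspendedCycle G r q (commonNbrs G X u v)

variable {G : SimpleGraph V} {X Y : Finset V} {r d : ℕ}

theorem mem_nbrs {u v : V} : u ∈ nbrs G X v ↔ u ∈ X ∧ G.Adj v u := by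
  simp [nbrs]

theorem mem_commonNbrs {u v w : V} :
    w ∈ commonNbrs G X u v ↔ w ∈ X ∧ G.Adj u w ∧ G.Adj v w := by
  simp [commonNbrs]

theorem mem_cliques {i : ℕ} {S : Finset V} :
    S ∈ cliques G i X ↔ S ⊆ X ∧ S.card = i ∧ G.IsClique (S : Set V) := by
  simp [cliques, and_assoc]

theorem nbrs_subset (v : V) : nbrs G X v ⊆ X := Finset.filter_subset _ _

theorem commonNbrs_subset (u v : V) : commonNbrs G X u v ⊆ X := Finset.filter_subset _ _

theorem CliqueBound.mono (h : CliqueBound G Y d) (hXY : X ⊆ Y) : CliqueBound G X d :=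
  fun S hS hc => h S (hS.trans hXY) hc

theorem CliqueBound.pos (h : CliqueBound G X d) (hX : X.Nonempty) : 1 ≤ d := by
  obtain ⟨x, hx⟩ := hX
  simpa using h {x} (by simpa using hx) (by simp)

theorem HasInducedCycle.mono (h : HasInducedCycle G r X) (hXY : X ⊆ Y) :
    HasInducedCycle G r Y := by
  obtain ⟨x, hx, ℓ, v, h2, hr, hv, hvv⟩ := h
  exact ⟨x, hXY hx, ℓ, v, h2, hr, fun i hi => ⟨hXY (hv i hi).1, (hv i hi).2⟩, hvv⟩

theorem HasSuspendedCycle.mono {q : ℕ} (h : HasSuspendedCycle G r q X) (hXY : X ⊆ Y) :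
    HasSuspendedCycle G r q Y := by
  induction q generalizing X Y with
  | zero => exact HasInducedCycle.mono h hXY
  | succ q ih =>
    obtain ⟨u, hu, v, hv, hne, hadj, h⟩ := h
    exact ⟨u, hXY hu, v, hXY hv, hne, hadj, ih h (Finset.filter_subset_filter _ hXY)⟩

/-! ### Induced cycles from walks -/

/-- A shortest walk between two nonadjacent neighbours of `x` that otherwise avoids the closed
neighbourhood of `x` closes up to an induced cycle. -/
theorem hasInducedCycle_of_walk {x a b : V} (hx : x ∈ X) (ha : a ∈ X) (hb : b ∈ X)
    (hxa : G.Adj x a) (hxb : G.Adj x b) (hab : a ≠ b) (hnab : ¬ G.Adj a b) (ℓ : ℕ) (f : ℕ → V)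
    (h0 : f 0 = a) (hℓ : f ℓ = b) (hadj : ∀ i < ℓ, G.Adj (f i) (f (i + 1)))
    (hin : ∀ i, 0 < i → i < ℓ → f i ∈ X ∧ f i ≠ x ∧ ¬ G.Adj x (f i)) (hr : ℓ + 2 ≤ 2 * r) :
    HasInducedCycle G r X := by
  induction ℓ using Nat.strong_induction_on generalizing f with
  | _ ℓ ih =>
  -- A shortcut deletes the s vertices after position i; the last clause treats a deletion reaching
  -- the end of the walk. If there is none, the walk is already an induced path.
  by_cases h : ∃ i s, 0 < s ∧ i + s ≤ ℓ ∧ (i + s < ℓ → G.Adj (f i) (f (i + 1 + s))) ∧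
      (i + s = ℓ → f i = f ℓ)
  · obtain ⟨i, s, hs, his, h1, h2⟩ := h
    refine ih (ℓ - s) (by omega) (fun k => if k ≤ i then f k else f (k + s)) (by simp [h0]) ?_ ?_ ?_
      (by omega)
    · by_cases hc : ℓ - s ≤ i
      · have : ℓ - s = i := by omega
        simp only [this, le_refl, if_true]
        rw [h2 (by omega), hℓ]
      · simp only [hc, if_false]
        rw [Nat.sub_add_cancel (by omega), hℓ]
    · intro k hk
      rcases lt_trichotomy k i with hki | rfl | hki
      · simp only [hki.le, Nat.succ_le_of_lt hki, if_true]
        exact hadj k (by omega)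
      · simp only [le_refl, if_true, show ¬ k + 1 ≤ k by omega, if_false]
        exact h1 (by omega)
      · simp only [show ¬ k ≤ i by omega, show ¬ k + 1 ≤ i by omega, if_false]
        have := hadj (k + s) (by omega)
        rwa [show k + s + 1 = k + 1 + s by omega] at this
    · intro k hk0 hk
      by_cases hki : k ≤ i
      · simp only [hki, if_true]
        exact hin k hk0 (by omega)
      · simp only [hki, if_false]
        exact hin (k + s) (by omega) (by omega)
  · push Not at h
    have h2 : 2 ≤ ℓ := by
      by_contra hlt
      obtain rfl | rfl : ℓ = 0 ∨ ℓ = 1 := by omega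
      · exact hab (h0.symm.trans hℓ)
      · have := hadj 0 (by omega)
        rw [h0, zero_add, hℓ] at this
        exact hnab this
    have hne : ∀ i j, i < j → j ≤ ℓ → f i ≠ f j := by
      intro i j hij hj he
      have := h i (j - i) (by omega) (by omega) (fun hlt => by
        have := hadj j (by omega)
        rwa [← he, show j + 1 = i + 1 + (j - i) by omega] at this)
      exact this.2 (by rw [he]; congr 1; omega)
    refine ⟨x, hx, ℓ, f, h2, hr, fun i hi => ?_, fun i j hij hj => ⟨hne i j hij hj, ?_, ?_⟩⟩
    · rcases Nat.eq_zero_or_pos i with rfl | hi0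
      · rw [h0]
        exact ⟨ha, hxa.ne', by simp [hxa]⟩
      · rcases hi.eq_or_lt with rfl | hi
        · rw [hℓ]
          exact ⟨hb, hxb.ne', by simp [hxb]⟩
        · obtain ⟨h1, h2, h3⟩ := hin i hi0 hi
          exact ⟨h1, h2, by simp only [h3, false_iff]; omega⟩
    · intro hA
      by_contra hji
      have := h i (j - i - 1) (by omega) (by omega) (fun _ => by
        rwa [show i + 1 + (j - i - 1) = j by omega])
      omega
    · rintro rfl
      exact hadj i (by omega)

/-- A graph without short induced cycles has no induced four-cycle. -/
theorem isClique_commonNbrs (hr : 2 ≤ r) (hX : ¬ HasInducedCycle G r X) {u v : V} (hu : u ∈ X)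
    (hv : v ∈ X) (huv : u ≠ v) (hnuv : ¬ G.Adj u v) :
    G.IsClique (commonNbrs G X u v : Set V) := by
  intro a ha b hb hab
  by_contra hnab
  rw [Finset.mem_coe, mem_commonNbrs] at ha hb
  refine hX (hasInducedCycle_of_walk hu ha.1 hb.1 ha.2.1 hb.2.1 hab hnab 2
    (fun i => if i = 0 then a else if i = 1 then v else b) (by simp) (by simp) ?_ ?_ (by omega))
  · intro i hi
    obtain rfl | rfl : i = 0 ∨ i = 1 := by omega
    · simpa using ha.2.2.symm
    · simpa using hb.2.2
  · intro i h0 h2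
    obtain rfl : i = 1 := by omega
    simpa using ⟨hv, huv.symm, hnuv⟩

/-- Walks without chords of length two have no chords at all, as long as they are short. -/
theorem not_adj_of_locally_induced (hX : ¬ HasInducedCycle G r X) {L : ℕ} (hL : L + 1 ≤ 2 * r)
    (f : ℕ → V) (hf : ∀ i ≤ L, f i ∈ X) (hadj : ∀ i < L, G.Adj (f i) (f (i + 1)))
    (hloc : ∀ i, i + 2 ≤ L → f i ≠ f (i + 2) ∧ ¬ G.Adj (f i) (f (i + 2))) (j : ℕ) :
    ∀ s, 2 ≤ j → s + j ≤ L → f s ≠ f (s + j) ∧ ¬ G.Adj (f s) (f (s + j)) := by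
  induction j using Nat.strong_induction_on with
  | _ j ih =>
  intro s hj hs
  rcases hj.eq_or_lt with rfl | hj
  · exact hloc s hs
  refine ⟨fun he => ?_, fun hA => ?_⟩
  · have h1 := (ih (j - 1) (by omega) s (by omega) (by omega)).2
    have h2 := hadj (s + (j - 1)) (by omega)
    rw [show s + (j - 1) + 1 = s + j by omega, ← he] at h2
    exact h1 h2.symm
  -- A chord from f s to f (s + j) makes f (s + 1) and f (s + j) nonadjacent neighbours of f s,
  -- joined by a walk that otherwise avoids its closed neighbourhood; the cycle has at most j + 1 ≤
  -- 2r vertices.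
  · have h1 := ih (j - 1) (by omega) (s + 1) (by omega) (by omega)
    rw [show s + 1 + (j - 1) = s + j by omega] at h1
    refine hX (hasInducedCycle_of_walk (hf s (by omega)) (hf (s + 1) (by omega))
      (hf (s + j) (by omega)) (hadj s (by omega)) hA h1.1 h1.2 (j - 1) (fun i => f (s + 1 + i))
      (by simp) (by congr 1; omega) (fun i hi => hadj (s + 1 + i) (by omega)) ?_ (by omega))
    intro i hi0 hi
    have h3 := ih (i + 1) (by omega) s (by omega) (by omega)
    rw [show s + (i + 1) = s + 1 + i by omega] at h3
    exact ⟨hf _ (by omega), h3.1.symm, h3.2⟩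

/-! ### Density of nonadjacent pairs -/

/-- The vertices of `X` other than `v` that are not adjacent to `v`. -/
def nonNbrs (G : SimpleGraph V) (X : Finset V) (v : V) : Finset V :=
  X.filter fun w => v ≠ w ∧ ¬ G.Adj v w

theorem mem_nonNbrs {u v : V} : u ∈ nonNbrs G X v ↔ u ∈ X ∧ v ≠ u ∧ ¬ G.Adj v u := by
  simp [nonNbrs]

theorem card_le_commonNbrs_add {u v : V} (huv : u ≠ v) (hnuv : ¬ G.Adj u v) :
    X.card ≤ (commonNbrs G X u v).card + ((nonNbrs G X u).card + (nonNbrs G X v).card) := by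
  have hsub : X ⊆ commonNbrs G X u v ∪ (nonNbrs G X u ∪ nonNbrs G X v) := by
    intro w hw
    simp only [Finset.mem_union, mem_commonNbrs, mem_nonNbrs, hw, true_and]
    by_cases h1 : u = w
    · subst h1
      exact Or.inr (Or.inr ⟨huv.symm, fun h => hnuv h.symm⟩)
    · by_cases h2 : v = w
      · subst h2
        exact Or.inr (Or.inl ⟨h1, hnuv⟩)
      · tauto
  exact (Finset.card_le_card hsub).trans ((Finset.card_union_le _ _).trans
    (Nat.add_le_add_left (Finset.card_union_le _ _) _))

theorem card_nonNbrs_mono (hXY : X ⊆ Y) (v : V) :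
    (nonNbrs G X v).card ≤ (nonNbrs G Y v).card :=
  Finset.card_le_card (Finset.filter_subset_filter _ hXY)

/-- A nonadjacent pair covers `X` by its common neighbourhood and two sets of size at most D.
Passing to the common neighbourhood removes one suspension and costs 2D; at the bottom it is a
clique. -/
theorem card_le_of_nonNbrs_le (hr : 2 ≤ r) {q D : ℕ} (hX : ¬ HasSuspendedCycle G r q X)
    (hd : CliqueBound G X d) (hD : ∀ v ∈ X, (nonNbrs G X v).card ≤ D) :
    X.card ≤ d + 2 * (q + 1) * D := by
  induction q generalizing X with
  | zero =>
    by_cases hc : G.IsClique (X : Set V)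
    · exact (hd X subset_rfl hc).trans (Nat.le_add_right _ _)
    · simp only [SimpleGraph.IsClique, Set.Pairwise] at hc
      push Not at hc
      obtain ⟨u, hu, v, hv, huv, hnuv⟩ := hc
      have h1 := hd _ (commonNbrs_subset u v) (isClique_commonNbrs hr hX hu hv huv hnuv)
      have h2 := card_le_commonNbrs_add (X := X) huv hnuv
      have h3 := hD u hu
      have h4 := hD v hv
      omega
  | succ q ih =>
    by_cases hc : G.IsClique (X : Set V)
    · exact (hd X subset_rfl hc).trans (Nat.le_add_right _ _)
    · simp only [SimpleGraph.IsClique, Set.Pairwise] at hc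
      push Not at hc
      obtain ⟨u, hu, v, hv, huv, hnuv⟩ := hc
      have h1 := ih (X := commonNbrs G X u v) (fun h => hX ⟨u, hu, v, hv, huv, hnuv, h⟩)
        (hd.mono (commonNbrs_subset u v)) (fun w hw =>
          (card_nonNbrs_mono (commonNbrs_subset u v) w).trans (hD w (commonNbrs_subset u v hw)))
      have h2 := card_le_commonNbrs_add (X := X) huv hnuv
      have h3 := hD u hu
      have h4 := hD v hv
      calc X.card ≤ (d + 2 * (q + 1) * D) + (D + D) := by omega
        _ = _ := by ring

/-- A vertex set that is large compared to its clique number and contains no suspended cycle has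
positive density of nonadjacent pairs. -/
theorem sq_card_le_sum_nonNbrs (hr : 2 ≤ r) {q : ℕ} (hX : ¬ HasSuspendedCycle G r q X)
    (hd : CliqueBound G X d) (hlarge : 2 * d < X.card) :
    (X.card : ℝ) ^ 2 ≤ 32 * (q + 1) * ∑ v ∈ X, ((nonNbrs G X v).card : ℝ) := by
  set m := X.card with hm
  -- With this D the set Y has at most d + m/4 < 3m/4 elements, so at least a quarter of `X` has
  -- more than D nonneighbours; this gives 32 = 4 · 8.
  set D := m / (8 * (q + 1)) with hDdef
  set Y := X.filter fun v => (nonNbrs G X v).card ≤ D with hY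
  have hYX : Y ⊆ X := Finset.filter_subset _ _
  have h1 := card_le_of_nonNbrs_le (D := D) hr (fun h => hX (h.mono hYX)) (hd.mono hYX)
    (fun v hv => (card_nonNbrs_mono hYX v).trans (Finset.mem_filter.1 hv).2)
  have h2 : 8 * (q + 1) * D ≤ m := Nat.mul_div_le _ _
  have h3 : m < 8 * (q + 1) * (D + 1) := by
    rw [hDdef]
    exact Nat.lt_mul_div_succ _ (by omega)
  have hcard : Y.card + (X.filter fun v => ¬ (nonNbrs G X v).card ≤ D).card = m :=
    Finset.card_filter_add_card_filter_not _
  set Z := X.filter fun v => ¬ (nonNbrs G X v).card ≤ D with hZ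
  have h4 : (Z.card : ℝ) * (D + 1) ≤ ∑ v ∈ X, ((nonNbrs G X v).card : ℝ) := by
    calc (Z.card : ℝ) * (D + 1) = ∑ v ∈ Z, ((D : ℝ) + 1) := by rw [Finset.sum_const, nsmul_eq_mul]
      _ ≤ ∑ v ∈ Z, ((nonNbrs G X v).card : ℝ) := by
        refine Finset.sum_le_sum fun v hv => ?_
        have := (Finset.mem_filter.1 hv).2
        exact_mod_cast not_le.1 this
      _ ≤ _ := Finset.sum_le_sum_of_subset_of_nonneg (Finset.filter_subset _ _)
        fun _ _ _ => Nat.cast_nonneg _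
  have h5 : m ≤ 4 * Z.card := by
    have : 2 * (q + 1) * D * 4 = 8 * (q + 1) * D := by ring
    omega
  have h5' : (m : ℝ) ≤ 4 * Z.card := by exact_mod_cast h5
  have h3' : (m : ℝ) ≤ 8 * (q + 1) * (D + 1) := by exact_mod_cast h3.le
  calc (m : ℝ) ^ 2 = m * m := sq _
    _ ≤ (4 * Z.card) * (8 * (q + 1) * (D + 1)) := by gcongr
    _ = 32 * (q + 1) * (Z.card * (D + 1)) := by ring
    _ ≤ _ := by gcongr

/-- Double counting of triples (s, v, w) with v, w nonadjacent and both related to s. Here s is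
later a vertex adjacent to both, or a clique extended by both. -/
theorem sum_nonNbrs_comm {ι : Type*} (S : Finset ι) (R : ι → V → Prop) :
    ∑ s ∈ S, ∑ v ∈ X.filter (R s), (nonNbrs G (X.filter (R s)) v).card =
      ∑ v ∈ X, ∑ w ∈ nonNbrs G X v, (S.filter fun s => R s v ∧ R s w).card := by
  simp only [nonNbrs, Finset.card_filter, Finset.sum_filter]
  rw [Finset.sum_comm]
  refine Finset.sum_congr rfl fun v _ => ?_
  simp only [← Finset.sum_filter]
  rw [Finset.sum_filter, Finset.sum_filter]
  have : ∀ w, (if v ≠ w ∧ ¬ G.Adj v w then ∑ s ∈ S, (if R s v ∧ R s w then 1 else 0) else 0) =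
      ∑ s ∈ S, if v ≠ w ∧ ¬ G.Adj v w then (if R s v ∧ R s w then 1 else 0) else 0 := by
    intro w
    split_ifs <;> simp
  simp only [Finset.sum_filter]
  simp only [this]
  rw [Finset.sum_comm (s := X)]
  refine Finset.sum_congr rfl fun s _ => ?_
  by_cases hv : R s v
  · simp only [hv, if_true, true_and]
    refine Finset.sum_congr rfl fun w _ => ?_
    split_ifs <;> rfl
  · simp [hv]

/-- A neighbourhood with more than 2d vertices is rich in nonadjacent pairs, and each such pair lies
in at most d neighbourhoods. The smaller neighbourhoods add the 2 in 34 = 32 + 2. -/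
theorem sum_sq_nbrs_le (hr : 2 ≤ r) (hX : ¬ HasInducedCycle G r X) (hd : CliqueBound G X d) :
    ∑ x ∈ X, ((nbrs G X x).card : ℝ) ^ 2 ≤ 34 * d * (X.card : ℝ) ^ 2 := by
  have h1 : ∀ x ∈ X, ((nbrs G X x).card : ℝ) ^ 2 ≤ 2 * d * X.card +
      32 * ∑ v ∈ nbrs G X x, ((nonNbrs G (nbrs G X x) v).card : ℝ) := by
    intro x hx
    by_cases h : 2 * d < (nbrs G X x).card
    · have := sq_card_le_sum_nonNbrs (q := 0) hr (fun h => hX (h.mono (nbrs_subset x)))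
        (hd.mono (nbrs_subset x)) h
      simp only [Nat.cast_zero, zero_add, mul_one] at this
      have h0 : (0 : ℝ) ≤ 2 * d * X.card := by positivity
      linarith
    · have h2 : ((nbrs G X x).card : ℝ) ≤ 2 * d := by exact_mod_cast not_lt.1 h
      have h3 : ((nbrs G X x).card : ℝ) ≤ X.card := by
        exact_mod_cast Finset.card_le_card (nbrs_subset x)
      have h0 : (0 : ℝ) ≤ ∑ v ∈ nbrs G X x, ((nonNbrs G (nbrs G X x) v).card : ℝ) :=
        Finset.sum_nonneg fun _ _ => Nat.cast_nonneg _
      have h4 : ((nbrs G X x).card : ℝ) * (nbrs G X x).card ≤ 2 * d * X.card := by gcongr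
      nlinarith
  have h2 : ∑ x ∈ X, ∑ v ∈ nbrs G X x, ((nonNbrs G (nbrs G X x) v).card : ℝ) ≤
      d * (X.card : ℝ) ^ 2 := by
    have := sum_nonNbrs_comm (G := G) (X := X) X fun x v => G.Adj x v
    have h3 : ∑ v ∈ X, ∑ w ∈ nonNbrs G X v, (X.filter fun s => G.Adj s v ∧ G.Adj s w).card ≤
        ∑ v ∈ X, ∑ w ∈ X, d := by
      refine Finset.sum_le_sum fun v hv => ?_
      refine (Finset.sum_le_sum fun w hw => ?_).trans
        (Finset.sum_le_sum_of_subset (Finset.filter_subset _ _))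
      obtain ⟨hw, hne, hadj⟩ := mem_nonNbrs.1 hw
      have h4 := hd _ (commonNbrs_subset v w) (isClique_commonNbrs hr hX hv hw hne hadj)
      simpa only [commonNbrs, G.adj_comm] using h4
    rw [← this] at h3
    simp only [Finset.sum_const, smul_eq_mul] at h3
    have h5 : X.card * (X.card * d) = d * X.card ^ 2 := by ring
    rw [h5] at h3
    exact_mod_cast h3
  calc ∑ x ∈ X, ((nbrs G X x).card : ℝ) ^ 2
      ≤ ∑ x ∈ X, (2 * d * X.card +
        32 * ∑ v ∈ nbrs G X x, ((nonNbrs G (nbrs G X x) v).card : ℝ)) := Finset.sum_le_sum h1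
    _ = 2 * d * (X.card : ℝ) ^ 2 +
        32 * ∑ x ∈ X, ∑ v ∈ nbrs G X x, ((nonNbrs G (nbrs G X x) v).card : ℝ) := by
      rw [Finset.sum_add_distrib, Finset.sum_const, nsmul_eq_mul, ← Finset.mul_sum]
      ring
    _ ≤ _ := by nlinarith

theorem card_eq_nonNbrs_add {v : V} (hv : v ∈ X) :
    X.card = (nonNbrs G X v).card + (nbrs G X v).card + 1 := by
  have h1 : X.card = (X.filter fun w => v = w ∨ G.Adj v w).card + (nonNbrs G X v).card := by
    rw [nonNbrs, ← Finset.card_filter_add_card_filter_not (s := X) fun w => v = w ∨ G.Adj v w]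
    simp only [not_or, ne_eq]
  have h2 : (X.filter fun w => v = w ∨ G.Adj v w) = insert v (nbrs G X v) := by
    ext w
    simp only [Finset.mem_filter, Finset.mem_insert, mem_nbrs]
    constructor
    · rintro ⟨hw, rfl | h⟩
      · exact Or.inl rfl
      · exact Or.inr ⟨hw, h⟩
    · rintro (rfl | ⟨hw, h⟩)
      · exact ⟨hv, Or.inl rfl⟩
      · exact ⟨hw, Or.inr h⟩
  rw [h1, h2, Finset.card_insert_of_notMem (by simp [mem_nbrs])]
  omega

/-- A vertex set without induced four-cycles that is much larger than its clique number is
sparse. -/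
theorem sum_card_sub_nonNbrs_le (hr : 2 ≤ r) (hX : ¬ HasInducedCycle G r X)
    (hd : CliqueBound G X d) (hlarge : 544 * r ^ 2 * d ≤ X.card) :
    ∑ v ∈ X, ((X.card : ℝ) - (nonNbrs G X v).card) ≤ 1 / (2 * r) * (X.card : ℝ) ^ 2 := by
  rcases X.eq_empty_or_nonempty with rfl | hne
  · simp
  have hd1 := hd.pos hne
  have hr0 : (2 : ℝ) ≤ r := by exact_mod_cast hr
  have hl : 544 * (r : ℝ) ^ 2 * d ≤ X.card := by exact_mod_cast hlarge
  set m : ℝ := (X.card : ℝ) with hm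
  have hd1' : (1 : ℝ) ≤ d := by exact_mod_cast hd1
  have h1 : ∑ v ∈ X, (m - (nonNbrs G X v).card) = ∑ v ∈ X, ((nbrs G X v).card : ℝ) + m := by
    have : ∀ v ∈ X, m - (nonNbrs G X v).card = (nbrs G X v).card + 1 := by
      intro v hv
      rw [hm, card_eq_nonNbrs_add (G := G) hv]
      push_cast
      ring
    rw [Finset.sum_congr rfl this, Finset.sum_add_distrib]
    simp [hm]
  set A := ∑ v ∈ X, ((nbrs G X v).card : ℝ) with hA
  have h2 : A ^ 2 ≤ m * (34 * d * m ^ 2) :=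
    sq_sum_le_card_mul_sum_sq.trans (by gcongr; exact sum_sq_nbrs_le hr hX hd)
  have hm0 : 0 ≤ m := Nat.cast_nonneg _
  -- Since 544 = 34 · 16, the size hypothesis turns A² ≤ 34 d m³ into this bound, half of the
  -- target; the other half absorbs the diagonal term m.
  have h3 : A ≤ m ^ 2 / (4 * r) := by
    refine le_of_sq_le_sq ?_ (by positivity)
    rw [div_pow, le_div_iff₀ (by positivity)]
    calc A ^ 2 * (4 * r) ^ 2 ≤ m * (34 * d * m ^ 2) * (4 * r) ^ 2 := by gcongr
      _ = (544 * r ^ 2 * d) * m ^ 3 := by ring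
      _ ≤ m * m ^ 3 := by gcongr
      _ = _ := by ring
  have h4 : m ≤ m ^ 2 / (4 * r) := by
    rw [le_div_iff₀ (by positivity), sq]
    have : 4 * r ≤ m := by nlinarith
    gcongr
  rw [h1]
  calc A + m ≤ m ^ 2 / (4 * r) + m ^ 2 / (4 * r) := add_le_add h3 h4
    _ = _ := by field_simp; ring

/-! ### Chordless walks and a vertex of small degree -/

/-- The probability that a random walk in `X` which has just moved from `u` to `v` makes `ℓ`
further steps without a chord of length two. -/
def chordlessProb (G : SimpleGraph V) (X : Finset V) : ℕ → V → V → ℝ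
  | 0, _, _ => 1
  | ℓ + 1, u, v => (∑ w ∈ nonNbrs G (nbrs G X v) u, chordlessProb G X ℓ v w) / (nbrs G X v).card

/-- The number of walks in `X` without a chord of length two that start with `u`, `v` and reach
`y` after `ℓ` further steps. -/
def chordlessWalks (G : SimpleGraph V) (X : Finset V) : ℕ → V → V → V → ℕ
  | 0, _, v, y => if v = y then 1 else 0
  | ℓ + 1, u, v, y => ∑ w ∈ nonNbrs G (nbrs G X v) u, chordlessWalks G X ℓ v w y

theorem chordlessProb_nonneg (ℓ : ℕ) : ∀ u v : V, 0 ≤ chordlessProb G X ℓ u v := by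
  induction ℓ with
  | zero => exact fun _ _ => zero_le_one
  | succ ℓ ih =>
    exact fun u v => div_nonneg (Finset.sum_nonneg fun w _ => ih v w) (Nat.cast_nonneg _)

theorem chordlessProb_le_one (ℓ : ℕ) : ∀ u v : V, chordlessProb G X ℓ u v ≤ 1 := by
  induction ℓ with
  | zero => exact fun _ _ => le_rfl
  | succ ℓ ih =>
    intro u v
    refine div_le_one_of_le₀ ((Finset.sum_le_sum fun w _ => ih v w).trans ?_) (Nat.cast_nonneg _)
    rw [Finset.sum_const, nsmul_eq_mul, mul_one]
    exact_mod_cast Finset.card_le_card (Finset.filter_subset _ _)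

theorem sum_nbrs_comm {M : Type*} [AddCommMonoid M] (f : V → V → M) :
    ∑ v ∈ X, ∑ u ∈ nbrs G X v, f u v = ∑ v ∈ X, ∑ u ∈ nbrs G X v, f v u := by
  refine Finset.sum_comm' fun v u => ?_
  simp only [mem_nbrs, G.adj_comm u v]
  tauto

/-- Union bound over the steps: the uniform distribution on directed edges is stationary for the
walk, so each step creates a chord with probability at most η. -/
theorem sum_one_sub_chordlessProb_le {η : ℝ}
    (hη : ∀ v ∈ X, ∑ u ∈ nbrs G X v, (((nbrs G X v).card : ℝ) -
      (nonNbrs G (nbrs G X v) u).card) ≤ η * ((nbrs G X v).card : ℝ) ^ 2) (ℓ : ℕ) :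
    ∑ v ∈ X, ∑ u ∈ nbrs G X v, (1 - chordlessProb G X ℓ u v) ≤
      ℓ * η * ∑ v ∈ X, ((nbrs G X v).card : ℝ) := by
  induction ℓ with
  | zero => simp [chordlessProb]
  | succ ℓ ih =>
    have key : ∀ v ∈ X, ∑ u ∈ nbrs G X v, (1 - chordlessProb G X (ℓ + 1) u v) ≤
        η * (nbrs G X v).card + ∑ w ∈ nbrs G X v, (1 - chordlessProb G X ℓ v w) := by
      intro v hv
      rcases (nbrs G X v).eq_empty_or_nonempty with h0 | hne
      · simp [h0]
      have hD : (0 : ℝ) < (nbrs G X v).card := by exact_mod_cast hne.card_pos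
      set D : ℝ := ((nbrs G X v).card : ℝ) with hDdef
      set T := ∑ w ∈ nbrs G X v, (1 - chordlessProb G X ℓ v w) with hT
      have h1 : ∀ u ∈ nbrs G X v, 1 - chordlessProb G X (ℓ + 1) u v ≤
          ((D - (nonNbrs G (nbrs G X v) u).card) + T) / D := by
        intro u hu
        rw [chordlessProb, le_div_iff₀ hD, sub_mul, ← hDdef, div_mul_cancel₀ _ hD.ne', one_mul]
        have h2 : ∑ w ∈ nonNbrs G (nbrs G X v) u, (1 - chordlessProb G X ℓ v w) ≤ T :=
          Finset.sum_le_sum_of_subset_of_nonneg (Finset.filter_subset _ _)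
            fun w _ _ => sub_nonneg.2 (chordlessProb_le_one ℓ v w)
        rw [Finset.sum_sub_distrib, Finset.sum_const, nsmul_eq_mul, mul_one] at h2
        linarith
      refine (Finset.sum_le_sum h1).trans ?_
      rw [← Finset.sum_div, Finset.sum_add_distrib, Finset.sum_const, nsmul_eq_mul, ← hDdef,
        div_le_iff₀ hD]
      have := hη v hv
      nlinarith
    refine (Finset.sum_le_sum key).trans ?_
    rw [Finset.sum_add_distrib, ← Finset.mul_sum,
      ← sum_nbrs_comm (fun u v => 1 - chordlessProb G X ℓ u v)]
    push_cast
    linarith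

/-- Each step has probability at most 1/δ, so a single walk has weight at most δ^(-ℓ). -/
theorem pow_mul_chordlessProb_le {δ : ℝ} (hδ : 0 < δ)
    (hX : ∀ v ∈ X, δ ≤ (nbrs G X v).card) (ℓ : ℕ) :
    ∀ u, ∀ v ∈ X, δ ^ ℓ * chordlessProb G X ℓ u v ≤
      ∑ y ∈ X, (chordlessWalks G X ℓ u v y : ℝ) := by
  induction ℓ with
  | zero =>
    intro u v hv
    simp [chordlessProb, chordlessWalks, hv]
  | succ ℓ ih =>
    intro u v hv
    simp only [chordlessProb, chordlessWalks]
    push_cast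
    rw [Finset.sum_comm]
    have hD : 0 < ((nbrs G X v).card : ℝ) := hδ.trans_le (hX v hv)
    have h0 : 0 ≤ ∑ w ∈ nonNbrs G (nbrs G X v) u, chordlessProb G X ℓ v w :=
      Finset.sum_nonneg fun w _ => chordlessProb_nonneg ℓ v w
    calc δ ^ (ℓ + 1) * ((∑ w ∈ nonNbrs G (nbrs G X v) u, chordlessProb G X ℓ v w) /
          (nbrs G X v).card)
        = δ / (nbrs G X v).card *
          (δ ^ ℓ * ∑ w ∈ nonNbrs G (nbrs G X v) u, chordlessProb G X ℓ v w) := by ring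
      _ ≤ 1 * (δ ^ ℓ * ∑ w ∈ nonNbrs G (nbrs G X v) u, chordlessProb G X ℓ v w) := by
        gcongr
        exact (div_le_one hD).2 (hX v hv)
      _ = ∑ w ∈ nonNbrs G (nbrs G X v) u, δ ^ ℓ * chordlessProb G X ℓ v w := by
        rw [one_mul, Finset.mul_sum]
      _ ≤ _ := Finset.sum_le_sum fun w hw =>
        ih v w (mem_nbrs.1 (mem_nonNbrs.1 hw).1).1

theorem exists_walk_of_chordlessWalks_ne_zero (ℓ : ℕ) :
    ∀ u v y : V, u ∈ X → v ∈ X → G.Adj u v → chordlessWalks G X ℓ u v y ≠ 0 →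
      ∃ f : ℕ → V, f 0 = u ∧ f 1 = v ∧ f (ℓ + 1) = y ∧ (∀ i ≤ ℓ + 1, f i ∈ X) ∧
        (∀ i < ℓ + 1, G.Adj (f i) (f (i + 1))) ∧
        ∀ i, i + 2 ≤ ℓ + 1 → f i ≠ f (i + 2) ∧ ¬ G.Adj (f i) (f (i + 2)) := by
  induction ℓ with
  | zero =>
    intro u v y hu hv huv h
    have hvy : v = y := by
      by_contra hne
      simp [chordlessWalks, hne] at h
    subst hvy
    refine ⟨fun i => if i = 0 then u else v, by simp, by simp, by simp, ?_, ?_, by omega⟩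
    · intro i _
      dsimp only
      split_ifs <;> assumption
    · intro i hi
      obtain rfl : i = 0 := by omega
      simpa using huv
  | succ ℓ ih =>
    intro u v y hu hv huv h
    obtain ⟨w, hw, hne⟩ := Finset.exists_ne_zero_of_sum_ne_zero h
    obtain ⟨hw, huw, hnuw⟩ := mem_nonNbrs.1 hw
    obtain ⟨hwX, hvw⟩ := mem_nbrs.1 hw
    obtain ⟨f, f0, f1, fy, fX, fadj, floc⟩ := ih v w y hv hwX hvw hne
    refine ⟨fun i => Nat.casesOn i u f, rfl, f0, fy, ?_, ?_, ?_⟩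
    · rintro (_ | i) hi
      · exact hu
      · exact fX i (by omega)
    · rintro (_ | i) hi
      · simpa [f0] using huv
      · exact fadj i (by omega)
    · rintro (_ | i) hi
      · simpa [f1] using ⟨huw, hnuw⟩
      · exact floc i (by omega)

/-- The possible second vertices of chordless walks from x to y form a clique, so each step but the
last has at most d choices. -/
theorem sum_chordlessWalks_le (hX : ¬ HasInducedCycle G r X) (hd : CliqueBound G X d) (ℓ : ℕ)
    (hℓ : ℓ + 1 ≤ r) (y : V) :
    ∀ x ∈ X, ∑ v ∈ nbrs G X x, chordlessWalks G X ℓ x v y ≤ d ^ ℓ := by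
  induction ℓ with
  | zero =>
    intro x hx
    simp only [chordlessWalks, Finset.sum_ite_eq', pow_zero]
    split_ifs <;> simp
  | succ ℓ ih =>
    intro x hx
    set S := (nbrs G X x).filter fun v => chordlessWalks G X (ℓ + 1) x v y ≠ 0 with hS
    have hclique : G.IsClique (S : Set V) := by
      intro a ha b hb hab
      by_contra hnab
      rw [Finset.mem_coe, hS, Finset.mem_filter, mem_nbrs] at ha hb
      obtain ⟨⟨haX, hxa⟩, ha⟩ := ha
      obtain ⟨⟨hbX, hxb⟩, hb⟩ := hb
      obtain ⟨f, f0, f1, fy, fX, fadj, floc⟩ :=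
        exists_walk_of_chordlessWalks_ne_zero _ _ _ _ hx haX hxa ha
      obtain ⟨g, g0, g1, gy, gX, gadj, gloc⟩ :=
        exists_walk_of_chordlessWalks_ne_zero _ _ _ _ hx hbX hxb hb
      have hf := fun j => not_adj_of_locally_induced hX (by omega) f fX fadj floc j 0
      have hg := fun j => not_adj_of_locally_induced hX (by omega) g gX gadj gloc j 0
      simp only [f0, zero_add] at hf
      simp only [g0, zero_add] at hg
      -- Follow f from a to y and return along g to b; neither walk meets the closed neighbourhood
      -- of x again.
      refine hX (hasInducedCycle_of_walk hx haX hbX hxa hxb hab hnab (2 * (ℓ + 1))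
        (fun i => if i ≤ ℓ + 1 then f (i + 1) else g (2 * (ℓ + 1) + 1 - i)) ?_ ?_ ?_ ?_ (by omega))
      · simpa using f1
      · simp only [show ¬ 2 * (ℓ + 1) ≤ ℓ + 1 by omega, if_false]
        rw [show 2 * (ℓ + 1) + 1 - 2 * (ℓ + 1) = 1 by omega, g1]
      · intro i hi
        rcases lt_trichotomy i (ℓ + 1) with h | rfl | h
        · simp only [show i ≤ ℓ + 1 by omega, show i + 1 ≤ ℓ + 1 by omega, if_true]
          exact fadj (i + 1) (by omega)
        · simp only [le_refl, if_true, show ¬ ℓ + 1 + 1 ≤ ℓ + 1 by omega, if_false]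
          rw [fy, ← gy, show 2 * (ℓ + 1) + 1 - (ℓ + 1 + 1) = ℓ + 1 by omega]
          exact (gadj (ℓ + 1) (by omega)).symm
        · simp only [show ¬ i ≤ ℓ + 1 by omega, show ¬ i + 1 ≤ ℓ + 1 by omega, if_false]
          have := gadj (2 * (ℓ + 1) + 1 - (i + 1)) (by omega)
          rw [show 2 * (ℓ + 1) + 1 - (i + 1) + 1 = 2 * (ℓ + 1) + 1 - i by omega] at this
          exact this.symm
      · intro i h0 hi
        by_cases h : i ≤ ℓ + 1
        · simp only [h, if_true]
          have := hf (i + 1) (by omega) (by omega)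
          exact ⟨fX _ (by omega), this.1.symm, this.2⟩
        · simp only [h, if_false]
          have := hg (2 * (ℓ + 1) + 1 - i) (by omega) (by omega)
          exact ⟨gX _ (by omega), this.1.symm, this.2⟩
    calc ∑ v ∈ nbrs G X x, chordlessWalks G X (ℓ + 1) x v y
        = ∑ v ∈ S, chordlessWalks G X (ℓ + 1) x v y := by
          rw [hS, Finset.sum_filter_ne_zero]
      _ ≤ ∑ v ∈ S, d ^ ℓ := by
        refine Finset.sum_le_sum fun v hv => ?_
        have hvX := (mem_nbrs.1 (Finset.mem_filter.1 hv).1).1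
        exact (Finset.sum_le_sum_of_subset (Finset.filter_subset _ _)).trans
          (ih (by omega) v hvX)
      _ = S.card * d ^ ℓ := by rw [Finset.sum_const, smul_eq_mul]
      _ ≤ d * d ^ ℓ := Nat.mul_le_mul_right _
        (hd S ((Finset.filter_subset _ _).trans (nbrs_subset x)) hclique)
      _ = _ := by ring

/-- A graph without short induced cycles has a vertex of small degree. -/
theorem exists_nbrs_pow_le (hr : 2 ≤ r) (hX : ¬ HasInducedCycle G r X) (hd : CliqueBound G X d)
    (hne : X.Nonempty) :
    ∃ v ∈ X, ((nbrs G X v).card : ℝ) ^ r ≤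
      (544 * (r : ℝ) ^ 2) ^ (r - 1) * (d : ℝ) ^ (r - 1) * X.card := by
  obtain ⟨v₀, hv₀, hmin⟩ := X.exists_min_image (fun v => (nbrs G X v).card) hne
  refine ⟨v₀, hv₀, ?_⟩
  set n := (nbrs G X v₀).card with hn
  have hr0 : (2 : ℝ) ≤ r := by exact_mod_cast hr
  have hrr : r - 1 + 1 = r := by omega
  by_cases hlarge : 544 * r ^ 2 * d ≤ n
  · have hd1 := hd.pos hne
    have hn0 : 0 < n := lt_of_lt_of_le (by positivity) hlarge
    have hn0' : (0 : ℝ) < n := by exact_mod_cast hn0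
    have hmin' : ∀ v ∈ X, (n : ℝ) ≤ (nbrs G X v).card := fun v hv => by exact_mod_cast hmin v hv
    -- By minimality of n all neighbourhoods are large, hence sparse; with η = 1/(2r), the r - 1
    -- steps lose at most half of the total weight E.
    have h1 := sum_one_sub_chordlessProb_le (X := X) (G := G) (η := 1 / (2 * r))
      (fun v hv => sum_card_sub_nonNbrs_le hr (fun h => hX (h.mono (nbrs_subset v)))
        (hd.mono (nbrs_subset v)) (hlarge.trans (hmin v hv))) (r - 1)
    set E := ∑ v ∈ X, ((nbrs G X v).card : ℝ) with hE
    have hE1 : X.card * (n : ℝ) ≤ E := by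
      rw [← nsmul_eq_mul, ← Finset.sum_const]
      exact Finset.sum_le_sum hmin'
    have h2 : E / 2 ≤ ∑ v ∈ X, ∑ u ∈ nbrs G X v, chordlessProb G X (r - 1) u v := by
      simp only [Finset.sum_sub_distrib, Finset.sum_const, nsmul_eq_mul, mul_one] at h1
      rw [← hE] at h1
      have h3 : ((r - 1 : ℕ) : ℝ) * (1 / (2 * r)) ≤ 1 / 2 := by
        rw [Nat.cast_sub (by omega), mul_one_div, div_le_div_iff₀ (by positivity) (by norm_num)]
        push_cast
        linarith
      have hE0 : 0 ≤ E := Finset.sum_nonneg fun _ _ => Nat.cast_nonneg _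
      nlinarith
    have h3 : (n : ℝ) ^ (r - 1) * (E / 2) ≤ (X.card : ℝ) * (X.card * (d : ℝ) ^ (r - 1)) := by
      calc (n : ℝ) ^ (r - 1) * (E / 2)
          ≤ (n : ℝ) ^ (r - 1) * ∑ v ∈ X, ∑ u ∈ nbrs G X v, chordlessProb G X (r - 1) u v := by
            gcongr
        _ = ∑ v ∈ X, ∑ u ∈ nbrs G X v, (n : ℝ) ^ (r - 1) * chordlessProb G X (r - 1) u v := by
          simp only [Finset.mul_sum]
        _ ≤ ∑ v ∈ X, ∑ u ∈ nbrs G X v, ∑ y ∈ X, (chordlessWalks G X (r - 1) u v y : ℝ) :=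
          Finset.sum_le_sum fun v hv => Finset.sum_le_sum fun u _ =>
            pow_mul_chordlessProb_le hn0' hmin' _ u v hv
        _ = ∑ x ∈ X, ∑ y ∈ X, ∑ v ∈ nbrs G X x, (chordlessWalks G X (r - 1) x v y : ℝ) := by
          rw [sum_nbrs_comm fun u v => ∑ y ∈ X, (chordlessWalks G X (r - 1) u v y : ℝ)]
          exact Finset.sum_congr rfl fun x _ => Finset.sum_comm
        _ ≤ ∑ x ∈ X, ∑ y ∈ X, (d : ℝ) ^ (r - 1) :=
          Finset.sum_le_sum fun x hx => Finset.sum_le_sum fun y _ => by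
            exact_mod_cast sum_chordlessWalks_le hX hd (r - 1) (by omega) y x hx
        _ = _ := by simp only [Finset.sum_const, nsmul_eq_mul]
    have hm : (0 : ℝ) < X.card := by exact_mod_cast hne.card_pos
    have h4 : X.card * ((n : ℝ) ^ (r - 1) * n) ≤ X.card * (2 * X.card * (d : ℝ) ^ (r - 1)) := by
      have : (n : ℝ) ^ (r - 1) * (X.card * n) ≤ (n : ℝ) ^ (r - 1) * E := by gcongr
      linarith
    have h5 := le_of_mul_le_mul_left h4 hm
    rw [← pow_succ, hrr] at h5
    have h6 : (2 : ℝ) ≤ (544 * (r : ℝ) ^ 2) ^ (r - 1) := by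
      have : (2 : ℝ) ≤ 544 * (r : ℝ) ^ 2 := by nlinarith
      exact this.trans (le_self_pow₀ (by linarith) (by omega))
    calc (n : ℝ) ^ r ≤ 2 * (d : ℝ) ^ (r - 1) * X.card := by linarith
      _ ≤ _ := by gcongr
  -- Small degrees: bound r - 1 factors by the threshold and one by |X|.
  · have h1 : (n : ℝ) ≤ 544 * (r : ℝ) ^ 2 * d := by exact_mod_cast (not_le.1 hlarge).le
    have h2 : (n : ℝ) ≤ X.card := by exact_mod_cast Finset.card_le_card (nbrs_subset v₀)
    rw [← mul_pow]
    calc (n : ℝ) ^ r = (n : ℝ) ^ (r - 1) * n := by rw [← pow_succ, hrr]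
      _ ≤ _ := by gcongr

/-! ### Recursive clique counting -/

/-- The vertices of `X` adjacent to all vertices of `σ`. -/
def extensions (G : SimpleGraph V) (X σ : Finset V) : Finset V :=
  X.filter fun v => ∀ s ∈ σ, G.Adj s v

theorem extensions_subset (σ : Finset V) : extensions G X σ ⊆ X := Finset.filter_subset _ _

theorem card_cliques_le_pow (i : ℕ) : (cliques G i X).card ≤ X.card ^ i :=
  (Finset.card_filter_le _ _).trans (by
    rw [Finset.card_powersetCard]
    exact Nat.choose_le_pow _ _)

theorem card_cliques_empty (i : ℕ) : (cliques G (i + 1) ∅).card = 0 :=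
  Nat.le_zero.1 ((card_cliques_le_pow (i + 1)).trans (by simp))

theorem card_cliques_succ_le_sum (j : ℕ) :
    (cliques G (j + 1) X).card ≤
      ∑ σ ∈ cliques G j X, (extensions G X σ).card := by
  have hsub : cliques G (j + 1) X ⊆ (cliques G j X).biUnion fun σ =>
      (extensions G X σ).image fun v => insert v σ := by
    intro S hS
    obtain ⟨hSX, hcard, hS⟩ := mem_cliques.1 hS
    obtain ⟨v, hv⟩ := Finset.card_pos.1 (show 0 < S.card by omega)
    rw [Finset.mem_biUnion]
    refine ⟨S.erase v, mem_cliques.2 ⟨(Finset.erase_subset v S).trans hSX, ?_,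
      hS.subset (by exact_mod_cast Finset.erase_subset v S)⟩,
      Finset.mem_image.2 ⟨v, Finset.mem_filter.2 ⟨hSX hv, ?_⟩, Finset.insert_erase hv⟩⟩
    · rw [Finset.card_erase_of_mem hv, hcard, Nat.add_sub_cancel]
    · intro s hs
      exact hS (Finset.mem_of_mem_erase hs) hv (Finset.ne_of_mem_erase hs)
  exact (Finset.card_le_card hsub).trans (Finset.card_biUnion_le.trans
    (Finset.sum_le_sum fun σ _ => Finset.card_image_le))

theorem card_cliques_succ_le_add (j : ℕ) (v : V) :
    (cliques G (j + 1) X).card ≤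
      (cliques G (j + 1) (X.erase v)).card + (cliques G j (nbrs G X v)).card := by
  have hsub : cliques G (j + 1) X ⊆ cliques G (j + 1) (X.erase v) ∪
      (cliques G j (nbrs G X v)).image (insert v) := by
    intro S hS
    obtain ⟨hSX, hcard, hS⟩ := mem_cliques.1 hS
    rw [Finset.mem_union]
    by_cases hv : v ∈ S
    · refine Or.inr (Finset.mem_image.2 ⟨S.erase v, mem_cliques.2 ⟨?_, ?_,
        hS.subset (by exact_mod_cast Finset.erase_subset v S)⟩, Finset.insert_erase hv⟩)
      · intro w hw
        exact mem_nbrs.2 ⟨hSX (Finset.mem_of_mem_erase hw),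
          hS hv (Finset.mem_of_mem_erase hw) (Finset.ne_of_mem_erase hw).symm⟩
      · rw [Finset.card_erase_of_mem hv, hcard, Nat.add_sub_cancel]
    · exact Or.inl (mem_cliques.2 ⟨fun w hw => Finset.mem_erase.2
        ⟨fun h => hv (h ▸ hw), hSX hw⟩, hcard, hS⟩)
  exact (Finset.card_le_card hsub).trans ((Finset.card_union_le _ _).trans
    (Nat.add_le_add_left Finset.card_image_le _))

/-- The number of `i`-cliques in a vertex set with `m` elements and clique number at most `d` that
contains no `q`-fold suspension of an induced cycle of length at most `2 * r` is
`O(d ^ (i - a) * m ^ a)`. -/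
def HasCliqueCountBound.{u} (r q i : ℕ) (a : ℝ) : Prop :=
  ∃ C : ℝ, 0 ≤ C ∧ ∀ (V : Type u) (G : SimpleGraph V) (X : Finset V) (d : ℕ),
    ¬ HasSuspendedCycle G r q X → CliqueBound G X d →
      ((cliques G i X).card : ℝ) ≤ C * (d : ℝ) ^ ((i : ℝ) - a) * (X.card : ℝ) ^ a

theorem hasCliqueCountBound_self.{u} (r q i : ℕ) : HasCliqueCountBound.{u} r q i i := by
  refine ⟨1, zero_le_one, fun V G X d _ _ => ?_⟩
  rw [sub_self, Real.rpow_zero, Real.rpow_natCast, one_mul, one_mul]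
  exact_mod_cast card_cliques_le_pow i

/-- Delete vertices of small degree successively: each deletion destroys only the i-cliques of a
neighbourhood of size at most D, and there are |X| deletions. -/
theorem HasCliqueCountBound.succ_of_no_cycle.{u} (hr : 2 ≤ r) {i : ℕ} {a : ℝ} (ha : 0 ≤ a)
    (h : HasCliqueCountBound.{u} r 0 i a) :
    HasCliqueCountBound.{u} r 0 (i + 1) (1 + a / r) := by
  obtain ⟨C, hC, h⟩ := h
  have hr0 : (2 : ℝ) ≤ r := by exact_mod_cast hr
  set K : ℝ := (544 * (r : ℝ) ^ 2) ^ (r - 1) with hK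
  have hK0 : 0 ≤ K := by positivity
  refine ⟨C * K ^ (a / r), by positivity, fun V G X d hX hd => ?_⟩
  rcases X.eq_empty_or_nonempty with rfl | hne
  · rw [card_cliques_empty, Nat.cast_zero]
    positivity
  have hd0 : (0 : ℝ) < d := by exact_mod_cast hd.pos hne
  have hm0 : (0 : ℝ) < X.card := by exact_mod_cast hne.card_pos
  set D : ℝ := (K * (d : ℝ) ^ (r - 1) * X.card) ^ (1 / (r : ℝ)) with hD
  have key : ∀ n : ℕ, ∀ Y ⊆ X, Y.card = n →
      ((cliques G (i + 1) Y).card : ℝ) ≤ n * (C * (d : ℝ) ^ ((i : ℝ) - a) * D ^ a) := by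
    intro n
    induction n with
    | zero =>
      intro Y _ hY
      rw [Finset.card_eq_zero.1 hY, card_cliques_empty]
      simp
    | succ n ih =>
      intro Y hYX hY
      obtain ⟨v, hv, hdeg⟩ := exists_nbrs_pow_le hr (fun h => hX (HasInducedCycle.mono h hYX))
        (hd.mono hYX) (Finset.card_pos.1 (show 0 < Y.card by omega))
      have h1 := ih (Y.erase v) ((Finset.erase_subset v Y).trans hYX)
        (by rw [Finset.card_erase_of_mem hv, hY, Nat.add_sub_cancel])
      have hsub : nbrs G Y v ⊆ X := (nbrs_subset v).trans hYX
      have h2 := h V G (nbrs G Y v) d (fun h => hX (HasInducedCycle.mono h hsub)) (hd.mono hsub)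
      have h3 : ((nbrs G Y v).card : ℝ) ≤ D := by
        rw [hD, ← Real.pow_rpow_inv_natCast (Nat.cast_nonneg (nbrs G Y v).card)
          (show r ≠ 0 by omega), one_div]
        refine Real.rpow_le_rpow (by positivity) (hdeg.trans ?_) (by positivity)
        have : (Y.card : ℝ) ≤ X.card := by exact_mod_cast Finset.card_le_card hYX
        gcongr
      have h4 : ((nbrs G Y v).card : ℝ) ^ a ≤ D ^ a :=
        Real.rpow_le_rpow (Nat.cast_nonneg _) h3 ha
      have h5 : ((cliques G (i + 1) Y).card : ℝ) ≤
          (cliques G (i + 1) (Y.erase v)).card + (cliques G i (nbrs G Y v)).card := by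
        exact_mod_cast card_cliques_succ_le_add i v
      have h6 : C * (d : ℝ) ^ ((i : ℝ) - a) * ((nbrs G Y v).card : ℝ) ^ a ≤
          C * (d : ℝ) ^ ((i : ℝ) - a) * D ^ a := by gcongr
      push_cast
      linarith
  refine (key X.card X subset_rfl rfl).trans_eq ?_
  have h1 : D ^ a = K ^ (a / r) * (d : ℝ) ^ (a - a / r) * (X.card : ℝ) ^ (a / r) := by
    rw [hD, ← Real.rpow_mul (by positivity), Real.mul_rpow (by positivity) hm0.le,
      Real.mul_rpow hK0 (by positivity), ← Real.rpow_natCast, ← Real.rpow_mul hd0.le,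
      Nat.cast_sub (by omega), one_div_mul_eq_div, Nat.cast_one]
    congr 3
    field_simp
  have h2 : (d : ℝ) ^ (((i + 1 : ℕ) : ℝ) - (1 + a / r)) =
      (d : ℝ) ^ ((i : ℝ) - a) * (d : ℝ) ^ (a - a / r) := by
    rw [← Real.rpow_add hd0]
    congr 1
    push_cast
    ring
  rw [h1, h2, Real.rpow_add hm0, Real.rpow_one]
  ring

/-- Cauchy–Schwarz over σ. The squared sizes are controlled by nonadjacent pairs v, w of extensions;
for a fixed pair, the cliques σ lie in its common neighbourhood, whence `hpair`. -/
theorem sum_large_extensions_sq_le (hr : 2 ≤ r) {q j : ℕ} {P Q : ℝ}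
    (hX : ¬ HasSuspendedCycle G r (q + 1) X) (hd : CliqueBound G X d)
    (hP : ((cliques G j X).card : ℝ) ≤ P) (hQ : 0 ≤ Q)
    (hpair : ∀ v ∈ X, ∀ w ∈ nonNbrs G X v, ((cliques G j (commonNbrs G X v w)).card : ℝ) ≤ Q) :
    (∑ σ ∈ (cliques G j X).filter fun σ => 2 * d < (extensions G X σ).card,
      ((extensions G X σ).card : ℝ)) ^ 2 ≤
        P * (32 * (q + 2) * ((X.card : ℝ) ^ 2 * Q)) := by
  have hP0 : 0 ≤ P := (Nat.cast_nonneg _).trans hP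
  set S := cliques G j X with hS
  have hpairs : ∑ σ ∈ S, ∑ v ∈ extensions G X σ,
      ((nonNbrs G (extensions G X σ) v).card : ℝ) ≤ (X.card : ℝ) ^ 2 * Q := by
    have h3 : ∑ σ ∈ S, ∑ v ∈ extensions G X σ, ((nonNbrs G (extensions G X σ) v).card : ℝ) =
        ∑ v ∈ X, ∑ w ∈ nonNbrs G X v, ((S.filter fun σ => (∀ s ∈ σ, G.Adj s v) ∧
          ∀ s ∈ σ, G.Adj s w).card : ℝ) := by
      have := sum_nonNbrs_comm (G := G) (X := X) S fun σ v => ∀ s ∈ σ, G.Adj s v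
      norm_cast
      convert this using 5 <;> (ext; simp [extensions])
    rw [h3]
    have h4 : ∀ v ∈ X, ∀ w ∈ nonNbrs G X v, ((S.filter fun σ => (∀ s ∈ σ, G.Adj s v) ∧
        ∀ s ∈ σ, G.Adj s w).card : ℝ) ≤ Q := by
      intro v hv w hw
      have h5 : (S.filter fun σ => (∀ s ∈ σ, G.Adj s v) ∧ ∀ s ∈ σ, G.Adj s w) ⊆
          cliques G j (commonNbrs G X v w) := by
        intro σ hσ
        obtain ⟨hσ, hσv, hσw⟩ := Finset.mem_filter.1 hσ
        obtain ⟨hσX, hσ⟩ := mem_cliques.1 hσ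
        exact mem_cliques.2 ⟨fun s hs =>
          mem_commonNbrs.2 ⟨hσX hs, (hσv s hs).symm, (hσw s hs).symm⟩, hσ⟩
      exact le_trans (by exact_mod_cast Finset.card_le_card h5) (hpair v hv w hw)
    calc _ ≤ ∑ v ∈ X, ∑ w ∈ X, Q :=
          Finset.sum_le_sum fun v hv => (Finset.sum_le_sum (h4 v hv)).trans
            (Finset.sum_le_sum_of_subset_of_nonneg (Finset.filter_subset _ _)
              fun _ _ _ => hQ)
      _ = _ := by
        simp only [Finset.sum_const, nsmul_eq_mul]
        ring
  set B := S.filter fun σ => 2 * d < (extensions G X σ).card with hB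
  have hBS : B ⊆ S := Finset.filter_subset _ _
  have h3 : ∑ σ ∈ B, ((extensions G X σ).card : ℝ) ^ 2 ≤
      32 * (q + 2) * ∑ σ ∈ S, ∑ v ∈ extensions G X σ,
        ((nonNbrs G (extensions G X σ) v).card : ℝ) := by
    have h5 : ∑ σ ∈ B, ∑ v ∈ extensions G X σ, ((nonNbrs G (extensions G X σ) v).card : ℝ) ≤
        ∑ σ ∈ S, ∑ v ∈ extensions G X σ, ((nonNbrs G (extensions G X σ) v).card : ℝ) :=
      Finset.sum_le_sum_of_subset_of_nonneg hBS fun σ _ _ =>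
        Finset.sum_nonneg fun _ _ => Nat.cast_nonneg _
    refine le_trans ?_ (mul_le_mul_of_nonneg_left h5 (by positivity))
    rw [Finset.mul_sum]
    refine Finset.sum_le_sum fun σ hσ => ?_
    have := sq_card_le_sum_nonNbrs (q := q + 1) hr (fun h => hX (h.mono (extensions_subset σ)))
      (hd.mono (extensions_subset σ)) (Finset.mem_filter.1 hσ).2
    push_cast at this
    rwa [show (q : ℝ) + 1 + 1 = q + 2 by ring] at this
  have h4 : (B.card : ℝ) ≤ P := le_trans (by exact_mod_cast Finset.card_le_card hBS) hP
  have h5 : 0 ≤ (32 * (q + 2) : ℝ) := by positivity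
  exact sq_sum_le_card_mul_sum_sq.trans (mul_le_mul h4
    (h3.trans (mul_le_mul_of_nonneg_left hpairs h5))
    (Finset.sum_nonneg fun _ _ => sq_nonneg _) hP0)

theorem sum_small_extensions_le (S : Finset (Finset V)) :
    ∑ σ ∈ S with ¬ 2 * d < (extensions G X σ).card, ((extensions G X σ).card : ℝ) ≤
      2 * d * S.card := by
  calc ∑ σ ∈ S with ¬ 2 * d < (extensions G X σ).card, ((extensions G X σ).card : ℝ)
      ≤ ∑ σ ∈ S with ¬ 2 * d < (extensions G X σ).card, (2 * d : ℝ) := by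
        refine Finset.sum_le_sum fun σ hσ => ?_
        exact_mod_cast not_lt.1 (Finset.mem_filter.1 hσ).2
    _ ≤ ∑ σ ∈ S, (2 * d : ℝ) :=
      Finset.sum_le_sum_of_subset_of_nonneg (Finset.filter_subset _ _)
        fun _ _ _ => by positivity
    _ = 2 * d * S.card := by
      rw [Finset.sum_const, nsmul_eq_mul]
      ring

/-- Absorbs the contribution of small extension sets into the main term, as d ≤ |X|. -/
theorem mul_rpow_mul_rpow_le {x y j b c : ℝ} (hx : 0 < x) (hxy : x ≤ y) (hbc : b ≤ c) :
    x * (x ^ (j - b) * y ^ b) ≤ x ^ (j + 1 - c) * y ^ c := by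
  have hy := hx.trans_le hxy
  have h1 : x * x ^ (j - b) = x ^ (j + 1 - c) * x ^ (c - b) := by
    nth_rewrite 1 [← Real.rpow_one x]
    rw [← Real.rpow_add hx, ← Real.rpow_add hx]
    congr 1
    ring
  calc x * (x ^ (j - b) * y ^ b) = x ^ (j + 1 - c) * (x ^ (c - b) * y ^ b) := by
        rw [← mul_assoc, h1, mul_assoc]
    _ ≤ x ^ (j + 1 - c) * (y ^ (c - b) * y ^ b) := by
      have := Real.rpow_le_rpow hx.le hxy (sub_nonneg.2 hbc)
      gcongr
    _ = _ := by rw [← Real.rpow_add hy, sub_add_cancel]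

/-- The recursion for the exponents is exactly what makes the Cauchy–Schwarz bound a perfect square.
-/
theorem rpow_mul_rpow_mean_sq {x y j a b c : ℝ} (hx : 0 < x) (hy : 0 < y)
    (hc : c = 1 / 2 * a + 1 / 2 * b + 1) :
    (x ^ (j + 1 - c) * y ^ c) ^ 2 = x ^ (j - b) * y ^ b * (y ^ 2 * (x ^ (j - a) * y ^ a)) := by
  have h1 : (x ^ (j + 1 - c)) ^ 2 = x ^ (j - b) * x ^ (j - a) := by
    rw [← Real.rpow_add hx, ← Real.rpow_mul_natCast hx.le, hc]
    congr 1
    push_cast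
    ring
  have h2 : (y ^ c) ^ 2 = y ^ b * y ^ 2 * y ^ a := by
    rw [← Real.rpow_natCast y 2, ← Real.rpow_add hy, ← Real.rpow_add hy,
      ← Real.rpow_mul_natCast hy.le, hc]
    congr 1
    push_cast
    ring
  rw [mul_pow, h1, h2]
  ring

theorem pow_le_rpow_mul_rpow {x y c : ℝ} {j : ℕ} (hy : 0 < y) (hyx : y ≤ x)
    (hcj : c ≤ j + 1) : y ^ (j + 1) ≤ x ^ ((j : ℝ) + 1 - c) * y ^ c := by
  have h1 : y ^ (j + 1) = y ^ ((j : ℝ) + 1 - c) * y ^ c := by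
    rw [← Real.rpow_add hy, ← Real.rpow_natCast]
    congr 1
    push_cast
    ring
  rw [h1]
  have := Real.rpow_le_rpow hy.le hyx (sub_nonneg.2 hcj)
  gcongr

theorem HasCliqueCountBound.succ.{u} (hr : 2 ≤ r) {q j : ℕ} {a b c : ℝ} (ha : 0 ≤ a) (haj : a ≤ j)
    (hbj : b ≤ j) (hc : c = 1 / 2 * a + 1 / 2 * b + 1) (hbc : b ≤ c)
    (h1 : HasCliqueCountBound.{u} r q j a) (h2 : HasCliqueCountBound.{u} r (q + 1) j b) :
    HasCliqueCountBound.{u} r (q + 1) (j + 1) c := by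
  obtain ⟨C₁, hC₁, h1⟩ := h1
  obtain ⟨C₂, hC₂, h2⟩ := h2
  set M : ℝ := 32 * (q + 2) * C₁ * C₂ with hM
  have hM0 : 0 ≤ M := by positivity
  -- The summands pay for the trivial case |X| < d, the extension sets of size at most 2d, and the
  -- larger ones.
  refine ⟨1 + 2 * C₂ + √M, by positivity, fun V G X d hX hd => ?_⟩
  rcases X.eq_empty_or_nonempty with rfl | hne
  · rw [card_cliques_empty, Nat.cast_zero]
    positivity
  have hd0 : (0 : ℝ) < d := by exact_mod_cast hd.pos hne
  have hm0 : (0 : ℝ) < X.card := by exact_mod_cast hne.card_pos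
  have hcj : c ≤ j + 1 := by linarith
  rw [mul_assoc, Nat.cast_add_one]
  have hM1 := Real.sqrt_nonneg M
  have hY0 : 0 ≤ (d : ℝ) ^ ((j : ℝ) + 1 - c) * (X.card : ℝ) ^ c := by positivity
  rcases lt_or_ge (X.card : ℝ) d with hmd | hmd
  · have h3 := pow_le_rpow_mul_rpow hm0 hmd.le hcj
    have h4 : ((cliques G (j + 1) X).card : ℝ) ≤ (X.card : ℝ) ^ (j + 1) := by
      exact_mod_cast card_cliques_le_pow (j + 1)
    nlinarith
  have hScard := h2 V G X d hX hd
  have hsum : ((cliques G (j + 1) X).card : ℝ) ≤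
      ∑ σ ∈ cliques G j X, ((extensions G X σ).card : ℝ) := by
    exact_mod_cast card_cliques_succ_le_sum j
  rw [← Finset.sum_filter_add_sum_filter_not _ fun σ => 2 * d < (extensions G X σ).card] at hsum
  have hsmall := sum_small_extensions_le (G := G) (X := X) (d := d) (cliques G j X)
  have hbig := sum_large_extensions_sq_le (Q := C₁ * (d : ℝ) ^ ((j : ℝ) - a) * (X.card : ℝ) ^ a)
    hr hX hd hScard (by positivity) (fun v hv w hw => by
      obtain ⟨hw, hvw, hnvw⟩ := mem_nonNbrs.1 hw
      have h6 := h1 V G (commonNbrs G X v w) d (fun h => hX ⟨v, hv, w, hw, hvw, hnvw, h⟩)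
        (hd.mono (commonNbrs_subset v w))
      have h7 : ((commonNbrs G X v w).card : ℝ) ≤ X.card := by
        exact_mod_cast Finset.card_le_card (commonNbrs_subset v w)
      have h8 := Real.rpow_le_rpow (Nat.cast_nonneg _) h7 ha
      exact h6.trans (by gcongr))
  have hmean := rpow_mul_rpow_mean_sq (j := j) hd0 hm0 hc
  have hmono := mul_rpow_mul_rpow_le (j := j) hd0 hmd hbc
  set Y : ℝ := (d : ℝ) ^ ((j : ℝ) + 1 - c) * (X.card : ℝ) ^ c
  have hbig' := le_of_sq_le_sq (b := √M * Y) (hbig.trans_eq (by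
    rw [mul_pow, Real.sq_sqrt hM0, hmean, hM]
    ring)) (by positivity)
  have hsmall' : 2 * (d : ℝ) * (cliques G j X).card ≤ 2 * C₂ * Y := by
    calc 2 * (d : ℝ) * (cliques G j X).card
        ≤ 2 * d * (C₂ * (d : ℝ) ^ ((j : ℝ) - b) * (X.card : ℝ) ^ b) := by gcongr
      _ = 2 * C₂ * (d * ((d : ℝ) ^ ((j : ℝ) - b) * (X.card : ℝ) ^ b)) := by ring
      _ ≤ _ := by gcongr
  linarith

/-! ### Arithmetic of the exponents and the clique bound -/

open GirthComplex (exponent exponent_base exponent_rec)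

theorem exponent_two_succ (r i : ℕ) : exponent 2 r (i + 1) = 1 + exponent 2 r i / r := by
  rw [exponent, exponent, Finset.sum_range_succ', Finset.sum_div]
  simp only [pow_succ, pow_zero]
  rw [add_comm]
  congr 1
  exact Finset.sum_congr rfl fun j _ => by ring

theorem exponent_two_nonneg (r i : ℕ) : 0 ≤ exponent 2 r i := by
  rw [exponent]
  positivity

theorem exponent_add_three_self (q r : ℕ) : exponent (q + 3) r (q + 2) = q + 2 := by
  have := exponent_base (q + 3) r (by omega)
  rw [show q + 3 - 1 = q + 2 by omega] at this
  rw [this]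
  push_cast
  ring

theorem exponent_add_three_succ (q r i : ℕ) (hi : q + 2 ≤ i) :
    exponent (q + 3) r (i + 1) =
      1 / 2 * exponent (q + 2) r i + 1 / 2 * exponent (q + 3) r i + 1 := by
  rw [exponent_rec (q + 3) r (i + 1) (by omega) (by omega)]
  simp

theorem exponent_le (q r i : ℕ) (hr : 2 ≤ r) (hi : q + 1 ≤ i) : exponent (q + 2) r i ≤ i := by
  induction q generalizing i with
  | zero =>
    have hr0 : (2 : ℝ) ≤ r := by exact_mod_cast hr
    calc exponent 2 r i = ∑ j ∈ Finset.range i, (1 / (r : ℝ)) ^ j := by rw [exponent]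
      _ ≤ ∑ j ∈ Finset.range i, 1 := by
        refine Finset.sum_le_sum fun j _ => pow_le_one₀ (by positivity) ?_
        rw [div_le_one (by linarith)]
        linarith
      _ = i := by simp
  | succ q ih =>
    induction i, hi using Nat.le_induction with
    | base =>
      rw [exponent_add_three_self]
      push_cast
      linarith
    | succ i hi ih' =>
      rw [exponent_add_three_succ q r i hi]
      have := ih i (by omega)
      push_cast
      linarith

theorem exponent_nonneg (q r i : ℕ) (hi : q + 1 ≤ i) : 0 ≤ exponent (q + 2) r i := by
  induction q generalizing i with
  | zero => exact exponent_two_nonneg r i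
  | succ q ih =>
    induction i, hi using Nat.le_induction with
    | base =>
      rw [exponent_add_three_self]
      positivity
    | succ i hi ih' =>
      rw [exponent_add_three_succ q r i hi]
      have := ih i (by omega)
      linarith

theorem exponent_self (q r : ℕ) : exponent (q + 2) r (q + 1) = q + 1 := by
  have := exponent_base (q + 2) r (by omega)
  rw [show q + 2 - 1 = q + 1 by omega] at this
  rw [this]
  push_cast
  ring

theorem exponent_le_succ (q r i : ℕ) (hi : q + 1 ≤ i) :
    exponent (q + 2) r i ≤ exponent (q + 2) r (i + 1) := by
  induction q generalizing i with
  | zero =>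
    rw [exponent, exponent, Finset.sum_range_succ]
    have : (0 : ℝ) ≤ (1 / (r : ℝ)) ^ i := by positivity
    linarith
  | succ q ih =>
    induction i, hi using Nat.le_induction with
    | base =>
      rw [exponent_add_three_succ q r _ le_rfl, exponent_add_three_self]
      have := ih (q + 1) le_rfl
      rw [exponent_self] at this
      linarith
    | succ i hi ih' =>
      have h1 := exponent_add_three_succ q r i hi
      have h2 := exponent_add_three_succ q r (i + 1) (by omega)
      have := ih i (by omega)
      change exponent (q + 3) r i ≤ exponent (q + 3) r (i + 1) at ih'
      change exponent (q + 3) r (i + 1) ≤ exponent (q + 3) r (i + 1 + 1)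
      linarith

/-- The clique count with the exponents of the recursion. -/
theorem hasCliqueCountBound.{u} (q r i : ℕ) (hr : 2 ≤ r) (hi : q + 1 ≤ i) :
    HasCliqueCountBound.{u} r q i (exponent (q + 2) r i) := by
  induction q generalizing i with
  | zero =>
    induction i, hi using Nat.le_induction with
    | base =>
      rw [exponent_self]
      simpa using hasCliqueCountBound_self.{u} r 0 1
    | succ i hi ih =>
      rw [exponent_two_succ]
      exact ih.succ_of_no_cycle hr (exponent_two_nonneg r i)
  | succ q ih =>
    induction i, hi using Nat.le_induction with
    | base =>
      -- Here the exponent equals i, so the trivial bound |X|^i suffices.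
      rw [exponent_self]
      simpa using hasCliqueCountBound_self.{u} r (q + 1) (q + 1 + 1)
    | succ i hi ih' =>
      exact (ih i (by omega)).succ hr (exponent_nonneg q r i (by omega))
        (exponent_le q r i hr (by omega)) (exponent_le (q + 1) r i hr hi)
        (exponent_add_three_succ q r i hi) (exponent_le_succ (q + 1) r i hi) ih'

end

end CliqueCount

namespace CliqueCount

noncomputable section

open GirthComplex

/-! ### Homology cycles from suspended induced cycles -/

section Chains

variable {V : Type*} [LinearOrder V] {k : Type*} [Field k]

/-- The cone with apex `u` over a chain `c`. -/
def cone (u : V) (c : Finset V → k) (F : Finset V) : k :=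
  if u ∈ F then (-1) ^ (F.filter (· < u)).card * c (F.erase u) else 0

/-- The oriented edge from `a` to `b`, up to sign, as a chain. -/
def edge (k : Type*) [Field k] (a b : V) : Finset V → k :=
  cone a (Pi.single {b} 1)

theorem cone_zero (u : V) : cone u (0 : Finset V → k) = 0 := by
  ext F
  simp [cone]

theorem cone_insert_ne_zero {u : V} {c : Finset V → k} {F : Finset V} (hu : u ∉ F)
    (hF : c F ≠ 0) : cone u c (insert u F) ≠ 0 := by
  rw [cone, if_pos (Finset.mem_insert_self u F), Finset.erase_insert hu]
  exact mul_ne_zero (pow_ne_zero _ (by simp)) hF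

theorem mem_of_cone_ne_zero {u : V} {c : Finset V → k} {F : Finset V} (h : cone u c F ≠ 0) :
    u ∈ F ∧ c (F.erase u) ≠ 0 := by
  by_cases hu : u ∈ F
  · rw [cone, if_pos hu] at h
    exact ⟨hu, right_ne_zero_of_mul h⟩
  · exact absurd (if_neg hu) h

theorem eq_of_edge_ne_zero {a b : V} {F : Finset V} (h : edge k a b F ≠ 0) : F = {a, b} := by
  obtain ⟨ha, h⟩ := mem_of_cone_ne_zero h
  have hb : F.erase a = {b} := by
    by_contra hne
    exact h (Pi.single_eq_of_ne hne 1)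
  rw [← Finset.insert_erase ha, hb]

theorem edge_apply_ne_zero {a b : V} (hab : a ≠ b) : edge k a b {a, b} ≠ 0 :=
  cone_insert_ne_zero (by simpa using hab) (by simp)

/-- Deleting the apex returns c. For any other vertex v, the presence of u or v changes exactly one
of the two sign counts, which produces the minus sign. -/
theorem boundary_cone [Fintype V] {u : V} {c : Finset V → k} (hc : ∀ F, u ∈ F → c F = 0) :
    boundary k (cone u c) = c - cone u (boundary k c) := by
  ext G
  by_cases hu : u ∈ G
  · have hcompl : (G.erase u)ᶜ = insert u Gᶜ := Finset.compl_erase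
    simp only [boundary, LinearMap.coe_mk, AddHom.coe_mk, Pi.sub_apply]
    rw [cone, if_pos hu, hc G hu, zero_sub, hcompl, Finset.sum_insert (by simpa using hu),
      hc _ (Finset.mem_insert_self _ _), mul_zero, zero_add, Finset.mul_sum,
      ← Finset.sum_neg_distrib]
    refine Finset.sum_congr rfl fun v hv => ?_
    rw [Finset.mem_compl] at hv
    have hvu : v ≠ u := fun h => hv (h ▸ hu)
    rw [cone, if_pos (Finset.mem_insert_of_mem hu), Finset.erase_insert_of_ne hvu,
      Finset.filter_insert, Finset.filter_erase]
    rcases lt_or_gt_of_ne hvu with h | h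
    · have hmem : u ∉ G.filter (· < v) := fun hm => (Finset.mem_filter.1 hm).2.not_gt h
      rw [if_pos h, Finset.card_insert_of_notMem (by simp [hv]), Finset.erase_eq_of_notMem hmem,
        pow_succ]
      ring
    · have hmem : u ∈ G.filter (· < v) := Finset.mem_filter.2 ⟨hu, h⟩
      rw [if_neg h.not_gt, ← Finset.card_erase_add_one hmem, pow_succ]
      ring
  · simp only [boundary, LinearMap.coe_mk, AddHom.coe_mk, Pi.sub_apply]
    rw [Finset.sum_eq_single_of_mem u (by simpa using hu)]
    · have h0 : cone u (boundary k c) G = 0 := if_neg hu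
      simp only [boundary, LinearMap.coe_mk, AddHom.coe_mk] at h0
      rw [h0, sub_zero, cone, if_pos (Finset.mem_insert_self _ _), Finset.erase_insert hu,
        Finset.filter_insert, if_neg (lt_irrefl u), ← mul_assoc, ← pow_add,
        Even.neg_one_pow ⟨_, rfl⟩, one_mul]
    · intro v _ hvu
      rw [cone, if_neg (by simp [hu, hvu.symm]), mul_zero]

theorem boundary_edge [Fintype V] {a b : V} (hab : a ≠ b) :
    boundary k (edge k a b) = Pi.single {b} 1 - Pi.single {a} 1 := by
  rw [edge, boundary_cone]
  · congr 1
    rw [boundary_single]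
    ext F
    simp only [Finset.sum_singleton, Finset.erase_singleton, Pi.smul_apply, cone]
    by_cases ha : a ∈ F
    · rw [if_pos ha]
      by_cases hF : F = {a}
      · subst hF
        simp [Finset.filter_singleton]
      · have h1 : F.erase a ≠ ∅ := fun h => hF (by rw [← Finset.insert_erase ha, h]; rfl)
        rw [Pi.single_eq_of_ne h1, Pi.single_eq_of_ne hF]
        simp
    · rw [if_neg ha, Pi.single_eq_of_ne]
      rintro rfl
      simp at ha
  · intro F hF
    refine Pi.single_eq_of_ne ?_ 1
    rintro rfl
    exact hab (Finset.mem_singleton.1 hF)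

/-- A clique cannot contain both u and v, so a suspension enlarges cliques by at most one vertex. -/
theorem CliqueBound.suspension {G : SimpleGraph V} {u v : V} {W : Finset V} {s : ℕ} (hW : CliqueBound G W s)
    (huv : u ≠ v) (hnuv : ¬ G.Adj u v) :
    CliqueBound G (insert u (insert v W)) (s + 1) := by
  have key : ∀ a : V, ∀ S ⊆ insert a W, G.IsClique (S : Set V) → S.card ≤ s + 1 := by
    intro a S hS hclique
    have h1 := hW (S.erase a) (Finset.subset_insert_iff.1 hS)
      (hclique.subset (by exact_mod_cast Finset.erase_subset a S))
    have h2 := Finset.pred_card_le_card_erase (s := S) (a := a)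
    omega
  intro S hS hclique
  by_cases hu : u ∈ S
  · refine key u S (fun w hw => ?_) hclique
    rcases Finset.mem_insert.1 (hS hw) with rfl | h
    · exact Finset.mem_insert_self _ _
    · rcases Finset.mem_insert.1 h with rfl | h
      · exact absurd (hclique hu hw huv) hnuv
      · exact Finset.mem_insert_of_mem h
  · refine key v S (fun w hw => ?_) hclique
    exact Finset.mem_of_mem_insert_of_ne (hS hw) fun h => hu (h ▸ hw)

/-- `z` is a nonzero cycle of the clique complex of `G` on `W`, supported on cliques with `s`
vertices. -/
structure IsCliqueCycle [Fintype V] (G : SimpleGraph V) (W : Finset V) (s : ℕ)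
    (z : Finset V → k) : Prop where
  ne_zero : z ≠ 0
  boundary_eq_zero : boundary k z = 0
  support : ∀ F, z F ≠ 0 → F ⊆ W ∧ G.IsClique (F : Set V) ∧ F.card = s

variable [Fintype V] {G : SimpleGraph V} {r : ℕ} {X : Finset V}

/-- The sum of the oriented edges around the cycle has telescoping boundary, and an induced cycle
with at least four vertices contains no triangle. -/
theorem HasInducedCycle.exists_isCliqueCycle (k : Type*) [Field k] (h : HasInducedCycle G r X) :
    ∃ W ⊆ X, W.card ≤ 2 * r ∧ CliqueBound G W 2 ∧
      ∃ z : Finset V → k, IsCliqueCycle G W 2 z := by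
  obtain ⟨x, hx, ℓ, v, h2, hr, hv, hvv⟩ := h
  obtain ⟨m, rfl⟩ : ∃ m, ℓ = m + 1 := ⟨ℓ - 1, by omega⟩
  -- The cycle in cyclic order, the extra vertex x coming last; it has m + 3 ≥ 4 vertices.
  set c : ℕ → V := fun i => if i ≤ m + 1 then v i else x with hc
  have hcv : ∀ i ≤ m + 1, c i = v i := fun i hi => if_pos hi
  have hcx : c (m + 2) = x := if_neg (by omega)
  have hcX : ∀ i ≤ m + 2, c i ∈ X := by
    intro i hi
    rcases hi.eq_or_lt with rfl | hi
    · rwa [hcx]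
    · rw [hcv i (by omega)]
      exact (hv i (by omega)).1
  have key : ∀ i j, i < j → j ≤ m + 2 →
      c i ≠ c j ∧ (G.Adj (c i) (c j) ↔ j = i + 1 ∨ (i = 0 ∧ j = m + 2)) := by
    intro i j hij hj
    rw [hcv i (by omega)]
    rcases hj.eq_or_lt with rfl | hj
    · obtain ⟨-, h1, h3⟩ := hv i (by omega)
      rw [hcx, G.adj_comm, h3]
      exact ⟨h1, by omega⟩
    · obtain ⟨h1, h3⟩ := hvv i j hij (by omega)
      rw [hcv j (by omega), h3]
      exact ⟨h1, by omega⟩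
  have hne : ∀ i j, i ≤ m + 2 → j ≤ m + 2 → i ≠ j → c i ≠ c j := by
    intro i j hi hj hij
    rcases lt_or_gt_of_ne hij with h | h
    · exact (key i j h hj).1
    · exact (key j i h hi).1.symm
  have hadj : ∀ i j, i ≤ m + 2 → j ≤ m + 2 → G.Adj (c i) (c j) →
      j = i + 1 ∨ i = j + 1 ∨ (i = 0 ∧ j = m + 2) ∨ (j = 0 ∧ i = m + 2) := by
    intro i j hi hj hA
    rcases lt_trichotomy i j with h | rfl | h
    · have := (key i j h hj).2.1 hA
      omega
    · exact absurd hA (G.irrefl)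
    · have := (key j i h hi).2.1 hA.symm
      omega
  set W := (Finset.range (m + 3)).image c with hW
  have hmemW : ∀ i ≤ m + 2, c i ∈ W := fun i hi =>
    Finset.mem_image_of_mem c (Finset.mem_range.2 (by omega))
  have hpair : ∀ i j, i ≤ m + 2 → j ≤ m + 2 → G.Adj (c i) (c j) →
      ({c i, c j} : Finset V) ⊆ W ∧ G.IsClique (({c i, c j} : Finset V) : Set V) ∧
        ({c i, c j} : Finset V).card = 2 := by
    intro i j hi hj hA
    refine ⟨?_, ?_, Finset.card_pair hA.ne⟩
    · rw [Finset.insert_subset_iff, Finset.singleton_subset_iff]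
      exact ⟨hmemW i hi, hmemW j hj⟩
    · rw [Finset.coe_pair, SimpleGraph.isClique_pair]
      exact fun _ => hA
  have hstep : ∀ i < m + 2, G.Adj (c i) (c (i + 1)) := fun i hi =>
    (key i (i + 1) (by omega) (by omega)).2.2 (Or.inl rfl)
  have hlast : G.Adj (c (m + 2)) (c 0) :=
    ((key 0 (m + 2) (by omega) le_rfl).2.2 (Or.inr ⟨rfl, rfl⟩)).symm
  refine ⟨W, ?_, Finset.card_image_le.trans (by rw [Finset.card_range]; omega), ?_,
    ∑ i ∈ Finset.range (m + 2), edge k (c i) (c (i + 1)) + edge k (c (m + 2)) (c 0), ?_, ?_, ?_⟩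
  · intro w hw
    obtain ⟨i, hi, rfl⟩ := Finset.mem_image.1 hw
    exact hcX i (by have := Finset.mem_range.1 hi; omega)
  · intro S hS hclique
    by_contra! hcard
    obtain ⟨a, b, e, ha, hb, he, hab, hae, hbe⟩ := Finset.two_lt_card_iff.1 hcard
    have h1 := hclique ha hb hab
    have h3 := hclique ha he hae
    have h4 := hclique hb he hbe
    obtain ⟨i, hi, rfl⟩ := Finset.mem_image.1 (hS ha)
    obtain ⟨j, hj, rfl⟩ := Finset.mem_image.1 (hS hb)
    obtain ⟨l, hl, rfl⟩ := Finset.mem_image.1 (hS he)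
    rw [Finset.mem_range] at hi hj hl
    have h5 := hadj i j (by omega) (by omega) h1
    have h6 := hadj i l (by omega) (by omega) h3
    have h7 := hadj j l (by omega) (by omega) h4
    have h8 : i ≠ j := fun h => hab (congrArg c h)
    have h9 : i ≠ l := fun h => hae (congrArg c h)
    have h10 : j ≠ l := fun h => hbe (congrArg c h)
    omega
  -- The closing edge differs from every path edge, so its coefficient survives.
  · intro h0
    have h1 := congrFun h0 {c (m + 2), c 0}
    rw [Pi.add_apply, Finset.sum_apply, Finset.sum_eq_zero, zero_add] at h1
    · exact edge_apply_ne_zero hlast.ne h1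
    · intro i hi
      rw [Finset.mem_range] at hi
      by_contra h3
      have h4 := eq_of_edge_ne_zero h3
      have h5 : c i ∈ ({c (m + 2), c 0} : Finset V) := h4 ▸ Finset.mem_insert_self _ _
      have h6 : c (i + 1) ∈ ({c (m + 2), c 0} : Finset V) := by
        rw [h4]
        exact Finset.mem_insert_of_mem (Finset.mem_singleton_self _)
      rw [Finset.mem_insert, Finset.mem_singleton] at h5 h6
      have h7 : i = 0 := by
        by_contra h
        exact h5.elim (hne _ _ (by omega) le_rfl (by omega)) (hne _ _ (by omega) (by omega) h)
      subst h7
      exact h6.elim (hne _ _ (by omega) le_rfl (by omega)) (hne _ _ (by omega) (by omega) (by omega))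
  · rw [map_add, map_sum, boundary_edge hlast.ne,
      Finset.sum_congr rfl fun i hi => boundary_edge (hstep i (Finset.mem_range.1 hi)).ne,
      Finset.sum_range_sub fun i => (Pi.single {c i} 1 : Finset V → k)]
    abel
  · intro F hF
    rw [Pi.add_apply, Finset.sum_apply] at hF
    by_cases h0 : edge k (c (m + 2)) (c 0) F = 0
    · rw [h0, add_zero] at hF
      obtain ⟨i, hi, h1⟩ := Finset.exists_ne_zero_of_sum_ne_zero hF
      rw [Finset.mem_range] at hi
      rw [eq_of_edge_ne_zero h1]
      exact hpair _ _ (by omega) (by omega) (hstep i hi)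
    · rw [eq_of_edge_ne_zero h0]
      exact hpair _ _ le_rfl (by omega) hlast

/-- Both cones have boundary z, so the difference is a cycle; faces through u do not contain v and
cannot cancel. -/
theorem IsCliqueCycle.suspension {u v : V} {W : Finset V} {s : ℕ} {z : Finset V → k}
    (hz : IsCliqueCycle G W s z) (huv : u ≠ v) (hW : W ⊆ commonNbrs G X u v) :
    IsCliqueCycle G (insert u (insert v W)) (s + 1) (cone u z - cone v z) := by
  have hadj : ∀ w ∈ W, G.Adj u w ∧ G.Adj v w := fun w hw => (mem_commonNbrs.1 (hW hw)).2
  have hu : u ∉ W := fun h => G.irrefl (hadj u h).1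
  have hv : v ∉ W := fun h => G.irrefl (hadj v h).2
  have hsupp : ∀ a ∈ ({u, v} : Finset V), (∀ w ∈ W, G.Adj a w) → ∀ F, cone a z F ≠ 0 →
      F ⊆ insert u (insert v W) ∧ G.IsClique (F : Set V) ∧ F.card = s + 1 := by
    intro a ha hadj F hF
    obtain ⟨haF, hF⟩ := mem_of_cone_ne_zero hF
    obtain ⟨h1, h2, h3⟩ := hz.support _ hF
    rw [← Finset.insert_erase haF]
    refine ⟨?_, ?_, by rw [Finset.card_insert_of_notMem (Finset.notMem_erase _ _), h3]⟩
    · intro w hw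
      simp only [Finset.mem_insert, Finset.mem_singleton] at ha hw ⊢
      rcases hw with rfl | hw
      · tauto
      · exact Or.inr (Or.inr (h1 hw))
    · rw [Finset.coe_insert, SimpleGraph.isClique_insert]
      exact ⟨h2, fun w hw _ => hadj w (h1 hw)⟩
  refine ⟨fun h0 => ?_, ?_, fun F hF => ?_⟩
  · obtain ⟨F, hF⟩ := Function.ne_iff.1 hz.ne_zero
    have hFW := (hz.support F hF).1
    have h1 := congrFun h0 (insert u F)
    have h2 : cone v z (insert u F) = 0 := by
      refine if_neg fun h => ?_
      rcases Finset.mem_insert.1 h with h | h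
      · exact huv h.symm
      · exact hv (hFW h)
    rw [Pi.sub_apply, h2, sub_zero] at h1
    exact cone_insert_ne_zero (fun h => hu (hFW h)) hF h1
  · have h1 : ∀ a ∉ W, ∀ F, a ∈ F → z F = 0 := by
      intro a ha F haF
      by_contra h
      exact ha ((hz.support F h).1 haF)
    rw [map_sub, boundary_cone (h1 u hu), boundary_cone (h1 v hv), hz.boundary_eq_zero, cone_zero,
      cone_zero, sub_self]
  · by_cases h0 : cone u z F = 0
    · refine hsupp v (by simp) (fun w hw => (hadj w hw).2) F fun h => hF ?_
      rw [Pi.sub_apply, h0, h, sub_zero]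
    · exact hsupp u (by simp) (fun w hw => (hadj w hw).1) F h0

theorem HasSuspendedCycle.exists_isCliqueCycle (k : Type*) [Field k] {q : ℕ}
    (h : HasSuspendedCycle G r q X) :
    ∃ W ⊆ X, W.card ≤ 2 * q + 2 * r ∧ CliqueBound G W (q + 2) ∧
      ∃ z : Finset V → k, IsCliqueCycle G W (q + 2) z := by
  induction q generalizing X with
  | zero =>
    simpa using HasInducedCycle.exists_isCliqueCycle k h
  | succ q ih =>
    obtain ⟨u, hu, v, hv, huv, hnuv, h⟩ := h
    obtain ⟨W, hW, hcard, hbound, z, hz⟩ := ih h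
    refine ⟨insert u (insert v W), ?_, ?_, hbound.suspension huv hnuv, _, hz.suspension huv hW⟩
    · simp only [Finset.insert_subset_iff]
      exact ⟨hu, hv, hW.trans (commonNbrs_subset u v)⟩
    · have h1 := Finset.card_insert_le u (insert v W)
      have h2 := Finset.card_insert_le v W
      omega

end Chains

/-! ### Flag complexes and their graphs -/

section Complex

variable {V : Type*} [LinearOrder V]

/-- The graph of a simplicial complex. -/
def complexGraph (Γ : PreAbstractSimplicialComplex V) : SimpleGraph V where
  Adj u v := u ≠ v ∧ {u, v} ∈ Γ
  symm := ⟨fun u v h => ⟨h.1.symm, by rw [Finset.pair_comm]; exact h.2⟩⟩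
  loopless := ⟨fun _ h => h.1 rfl⟩

variable {Γ : PreAbstractSimplicialComplex V}

theorem isClique_of_mem {F : Finset V} (hF : F ∈ Γ) : (complexGraph Γ).IsClique (F : Set V) := by
  intro u hu v hv huv
  refine ⟨huv, (Γ.isRelLowerSet_faces hF).2 ?_ (Finset.insert_nonempty _ _)⟩
  rw [Finset.insert_subset_iff, Finset.singleton_subset_iff]
  exact ⟨hu, hv⟩

theorem mem_of_isClique (hΓ : IsFlag Γ) {F : Finset V} (hne : F.Nonempty)
    (hF : (complexGraph Γ).IsClique (F : Set V)) : F ∈ Γ := by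
  refine (hΓ F fun T hT hcard => Or.inr ?_).resolve_left hne.ne_empty
  obtain ⟨u, v, huv, rfl⟩ := Finset.card_eq_two.1 hcard
  rw [Finset.insert_subset_iff, Finset.singleton_subset_iff] at hT
  exact (hF hT.1 hT.2 huv).2

theorem mem_of_mem_induced_link_empty {W F : Finset V} (h : F ∈ induced (link Γ ∅) W) :
    F ∈ Γ ∧ F ⊆ W := by
  obtain ⟨⟨_, _, h1⟩, h2⟩ := h
  rw [Finset.empty_union] at h1
  exact ⟨h1, h2⟩

variable [Fintype V]

theorem girth_le_of_hasSuspendedCycle (k : Type*) [Field k] (hΓ : IsFlag Γ) {r q : ℕ}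
    {X : Finset V} (h : HasSuspendedCycle (complexGraph Γ) r q X) :
    girth k Γ (q + 1) ≤ ((2 * q + 2 * r : ℕ) : ℕ∞) := by
  obtain ⟨W, -, hcard, hbound, z, hz⟩ := h.exists_isCliqueCycle k
  refine le_trans (sInf_le ⟨∅, W, Or.inl rfl, Finset.disjoint_empty_left W, ?_, rfl⟩)
    (by exact_mod_cast hcard)
  have hzc : z ∈ cycles k (induced (link Γ ∅) W) (q + 1) := by
    refine ⟨fun F hF => ?_, hz.boundary_eq_zero⟩
    obtain ⟨h1, h2, h3⟩ := hz.support F hF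
    have hne : F.Nonempty := Finset.card_pos.1 (by omega)
    refine ⟨Or.inr ⟨⟨hne, Finset.disjoint_empty_left F, ?_⟩, h1⟩, h3⟩
    rw [Finset.empty_union]
    exact mem_of_isClique hΓ hne h2
  rw [Submodule.Quotient.nontrivial_iff]
  intro htop
  have hmem : (⟨z, hzc⟩ : cycles k (induced (link Γ ∅) W) (q + 1)) ∈
      (boundaries k (induced (link Γ ∅) W) (q + 1)).submoduleOf _ := htop ▸ Submodule.mem_top
  obtain ⟨c, hc, hcz⟩ := hmem
  -- A bounding chain would live on cliques with q + 3 vertices in W, one more than `hbound` allows.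
  have hc0 : c = 0 := by
    ext F
    by_contra hF
    obtain ⟨h1, h2⟩ := hc F hF
    rcases h1 with rfl | h1
    · simp at h2
    · obtain ⟨h3, h4⟩ := mem_of_mem_induced_link_empty h1
      have := hbound F h4 (isClique_of_mem h3)
      omega
  rw [hc0, map_zero] at hcz
  exact hz.ne_zero hcz.symm

theorem cliqueBound_univ (hΓ : IsFlag Γ) {d : ℕ} (hd : dim Γ = (d : ℤ) - 1) :
    CliqueBound (complexGraph Γ) Finset.univ d := by
  intro S _ hS
  rcases S.eq_empty_or_nonempty with rfl | hne
  · simp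
  have hsup : sSup (Finset.card '' Γ.faces) = d := by
    rw [dim] at hd
    omega
  rw [← hsup]
  refine le_csSup ⟨Fintype.card V, ?_⟩ ⟨S, mem_of_isClique hΓ hne hS, rfl⟩
  rintro _ ⟨F, _, rfl⟩
  exact Finset.card_le_univ F

theorem faceNumber_le_card_cliques (i : ℕ) :
    faceNumber Γ i ≤ (cliques (complexGraph Γ) (i + 1) Finset.univ).card := by
  rw [← Set.ncard_coe_finset]
  refine Set.ncard_le_ncard (fun F hF => ?_)
  exact mem_cliques.2 ⟨Finset.subset_univ F, hF.2, isClique_of_mem hF.1⟩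

end Complex

end

end CliqueCount

theorem mainTheorem3 (p r i : ℕ) (hp : 2 ≤ p) (hr : 2 ≤ r) (hi : p - 1 ≤ i) :
    ∃ C : ℝ, ∀ (k : Type*) [Field k] (V : Type*) [Fintype V] [LinearOrder V]
      (Γ : PreAbstractSimplicialComplex V) (d n : ℕ),
      Fintype.card V = n →
      GirthComplex.dim Γ = (d : ℤ) - 1 →
      GirthComplex.IsFlag Γ →
      ((2 * p + 2 * r - 4 : ℕ) : ℕ∞) < GirthComplex.girth k Γ (p - 1) →
      (GirthComplex.faceNumber Γ (i - 1) : ℝ) ≤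
        C * (d : ℝ) ^ ((i : ℝ) - GirthComplex.exponent p r i) *
          (n : ℝ) ^ GirthComplex.exponent p r i := by
  obtain ⟨q, rfl⟩ : ∃ q, p = q + 2 := ⟨p - 2, by omega⟩
  obtain ⟨C, -, hC⟩ := CliqueCount.hasCliqueCountBound q r i hr (by omega)
  refine ⟨C, fun k _ V _ _ Γ d n hn hd hΓ hgirth => ?_⟩
  have hfree : ¬ CliqueCount.HasSuspendedCycle (CliqueCount.complexGraph Γ) r q Finset.univ := by
    intro h
    have := CliqueCount.girth_le_of_hasSuspendedCycle k hΓ h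
    rw [show 2 * (q + 2) + 2 * r - 4 = 2 * q + 2 * r by omega] at hgirth
    exact absurd hgirth this.not_gt
  have h1 := hC V (CliqueCount.complexGraph Γ) Finset.univ d hfree
    (CliqueCount.cliqueBound_univ hΓ hd)
  rw [Finset.card_univ, hn] at h1
  refine le_trans ?_ h1
  have h2 := CliqueCount.faceNumber_le_card_cliques (Γ := Γ) (i - 1)
  -- The subtraction is not truncated, since i ≥ p - 1 ≥ 1.
  rw [show i - 1 + 1 = i by omega] at h2
  exact_mod_cast h2
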